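/- For an integrable nonincreasing function $w:[0,\infty)\to[0,\infty)$, not identically zero, let $\|X\|_\infty=\sup\{x\ge 0: w(x)>0\}\in(0,\infty]$ be the right end point of its support and $h(x)=\int_x^\infty w(x')\,dx'$. If $h$ is $C^2$ on $[0,\|X\|_\infty)$, the beta function of $w$ is $\beta(x)=h''(x)h(x)/h'(x)^2$, $0\le x<\|X\|_\infty$. A solution of the Lifschitz-Slyozov-Wagner (LSW) system with initial data $w_0$ is a continuous function $w(x,t)\ge 0$ on $[0,\infty)\times[0,\infty)$, nonincreasing in $x$, with $w(\cdot,0)=w_0$, such that for all $t\ge 0$ $$\int_0^\infty w(x,t)\,dx=1,$$ and such that $w$ is differentiable and satisfies $$\frac{\partial w}{\partial t}(x,t)=\Big[1-\Big(\frac{x}{L(t)}\Big)^{1/3}\Big]\frac{\partial w}{\partial x}(x,t),\qquad L(t)^{1/3}=\frac13\int_0^\infty x^{-2/3}w(x,t)\,dx\Big/w(0,t),$$ at all points $x>0$, $t>0$ with $w(x,t)>0$. With $c(x,t)=-\partial w(x,t)/\partial x$, the mean cluster volume is $\Lambda(t)=\int_0^\infty x\,c(x,t)\,dx\big/\int_0^\infty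 c(x,t)\,dx$. Proposition 4.3. There is a universal constant $\beta_\infty>0$ with the following property. Let $w_0:[0,\infty)\to[0,\infty)$ be nonincreasing with $\int_0^\infty w_0(x)\,dx=1$, let $h_0(x)=\int_x^\infty w_0(x')\,dx'$ be $C^2$ on $[0,\|X_0\|_\infty)$, where $\|X_0\|_\infty$ is the right end point of the support of $w_0$, and suppose that the beta function $\beta_0$ of $w_0$ satisfies $$\sup_{0\le x<\|X_0\|_\infty}\beta_0(x)\le\beta_\infty\qquad\text{and}\qquad \liminf_{x\to\|X_0\|_\infty}\beta_0(x)>0 .$$ Then there is a constant $C>0$, depending only on the function $\beta_0$ (with its domain $[0,\|X_0\|_\infty)$), such that every solution $w$ of the LSW system with initial data $w_0$ satisfies $$\Lambda(T)\ge C\,T\qquad\text{for all } T\ge 1 .$$ -/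

import Mathlib

open Set Filter Topology MeasureTheory

noncomputable section

namespace LSW

/-- `‖X‖_∞` for the positive random variable `X` with `P(X > x) = w x / w 0`: the right end
point of the support of the decreasing function `w` on `[0, ∞)`. It may be `⊤`. -/
def supportEnd (w : ℝ → ℝ) : EReal :=
  sSup ((fun x : ℝ => (x : EReal)) '' {x : ℝ | 0 ≤ x ∧ 0 < w x})

/-- The real interval `[0, a)`, where `a` may be infinite. -/
def interval (a : EReal) : Set ℝ := {x : ℝ | 0 ≤ x ∧ (x : EReal) < a}

/-- The filter on the real line of `x → a` with `x < a`, where `a` may be infinite. -/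
def leftOf (a : EReal) : Filter ℝ := comap (fun x : ℝ => (x : EReal)) (𝓝[<] a)

/-- `h(x) = ∫_x^∞ w(x') dx'`. -/
def tail (w : ℝ → ℝ) (x : ℝ) : ℝ := ∫ y in Ioi x, w y

/-- The beta function `β(x) = h''(x) h(x) / h'(x)²` of `w`, for `0 ≤ x < ‖X‖_∞`; the derivatives
are taken inside this interval, hence one-sided at `x = 0`. -/
def beta (w : ℝ → ℝ) (x : ℝ) : ℝ :=
  iteratedDerivWithin 2 (tail w) (interval (supportEnd w)) x * tail w x
    / (derivWithin (tail w) (interval (supportEnd w)) x) ^ 2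

/-- Initial data: integrable nonnegative decreasing functions on `[0, ∞)` of mass one whose beta
function is defined, that is, `h` is `C²` on `[0, ‖X‖_∞)`. -/
structure IsInitialDatum (w₀ : ℝ → ℝ) : Prop where
  nonneg : ∀ x, 0 ≤ x → 0 ≤ w₀ x
  antitoneOn : AntitoneOn w₀ (Ici 0)
  integrableOn : IntegrableOn w₀ (Ioi 0)
  mass : ∫ x in Ioi (0 : ℝ), w₀ x = 1
  contDiffOn_tail : ContDiffOn ℝ 2 (tail w₀) (interval (supportEnd w₀))

/-- The parameter `L(t)`, given by
`L(t)^{1/3} = (1/3) ∫_0^∞ x^{-2/3} w(x,t) dx / w(0,t)`. -/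
def scale (w : ℝ → ℝ → ℝ) (t : ℝ) : ℝ :=
  ((1 / 3 : ℝ) * (∫ x in Ioi (0 : ℝ), x ^ (-(2 / 3) : ℝ) * w x t) / w 0 t) ^ 3

/-- `w x t` (first variable volume, second variable time) is a global solution of the LSW system
with initial data `w₀`. The function `w` is nonnegative, continuous up to `x = 0` and `t = 0`,
decreasing in `x`, of mass one at all times, and the transport equation
`∂w/∂t = [1 - (x / L(t))^{1/3}] ∂w/∂x` holds classically at all points with `x > 0`, `t > 0` and
`w > 0`. Nothing is asked on the curve that bounds the support of `w`, where `w` is continuous but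
in general not differentiable; beyond it `w = 0` and the equation is trivial. -/
structure IsSolution (w₀ : ℝ → ℝ) (w : ℝ → ℝ → ℝ) : Prop where
  continuousOn : ContinuousOn (fun p : ℝ × ℝ => w p.1 p.2) (Ici 0 ×ˢ Ici 0)
  nonneg : ∀ x t, 0 ≤ x → 0 ≤ t → 0 ≤ w x t
  antitoneOn : ∀ t, 0 ≤ t → AntitoneOn (fun x => w x t) (Ici 0)
  integrableOn : ∀ t, 0 ≤ t → IntegrableOn (fun x => w x t) (Ioi 0)
  mass : ∀ t, 0 ≤ t → ∫ x in Ioi (0 : ℝ), w x t = 1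
  initial : ∀ x, 0 ≤ x → w x 0 = w₀ x
  differentiableAt : ∀ x t, 0 < x → 0 < t → 0 < w x t →
    DifferentiableAt ℝ (fun p : ℝ × ℝ => w p.1 p.2) (x, t)
  transport : ∀ x t, 0 < x → 0 < t → 0 < w x t →
    deriv (fun s => w x s) t
      = (1 - (x / scale w t) ^ (1 / 3 : ℝ)) * deriv (fun y => w y t) x

/-- The cluster density `c = -∂w/∂x`, so that `w(x,t) = ∫_x^∞ c(x',t) dx'`. -/
def density (w : ℝ → ℝ → ℝ) (x t : ℝ) : ℝ := -deriv (fun y => w y t) x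

/-- The mean cluster volume `Λ(t) = ∫_0^∞ x c(x,t) dx / ∫_0^∞ c(x,t) dx`. -/
def meanVolume (w : ℝ → ℝ → ℝ) (t : ℝ) : ℝ :=
  (∫ x in Ioi (0 : ℝ), x * density w x t) / ∫ x in Ioi (0 : ℝ), density w x t

end LSW

end

namespace LSW

/-! Mass one and an integration by parts give Λ(t) = 1/w(0,t) (`meanVolume_eq`). By the equation
near x = 0, 1/w(0,t) grows at least linearly as soon as -∂w/∂x ≥ k w² at late times
(`sq_le_neg_deriv`, `inv_zero_ge`).

The bound β₀ ≤ 1/2 forces a bounded support [0, a] and makes w₀(x)/(a - x) nondecreasing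
(`isProfile`). The velocity -1 + (x/L)^{1/3} is concave in x, so the flow is concave, and this
property survives: for every A in the support at time t, w(·,t) lies above the chord from (0,
w(0,t)) to (A, 0) (`zero_mul_sub_le`). Integrating the chord against 1 and x^{-2/3} gives A w(0,t) ≤
2 and A^{1/3} ≤ (4/3) L^{1/3}.

The second bound controls the characteristics x = p³. Lower ones separate exponentially from one
near the top (`sub_le_exp`), so after a time T₀ all surviving volumes come from (a - ε, a), where β₀
≥ δ (`lt_start`). Moreover the slope of the flow is at most e⁶ times an inverse mean slope ratio,
uniformly in time (`slope_le`). Hence the decay of w₀ near a, which has the form -w₀' ≥ δ w₀/(a -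
x), is carried to -∂w/∂x ≥ k w² (`inv_sub_inv_ge`). Both T₀ and k depend on a, ε, δ alone, hence
only on β₀ and its domain. -/

theorem hasDerivAt_max_zero_sq (u : ℝ) :
    HasDerivAt (fun v : ℝ => (max v 0) ^ 2) (2 * max u 0) u := by
  rcases lt_trichotomy u 0 with hu | rfl | hu
  · rw [max_eq_right hu.le, mul_zero]
    refine (hasDerivAt_const u (0 : ℝ)).congr_of_eventuallyEq ?_
    filter_upwards [Iio_mem_nhds hu] with v hv
    rw [max_eq_right (le_of_lt hv)]; simp
  · have h : HasFDerivAt (fun v : ℝ => (max v 0) ^ 2) (0 : ℝ →L[ℝ] ℝ) 0 := by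
      refine Asymptotics.IsBigO.hasFDerivAt (n := 2) ?_ one_lt_two
      refine Asymptotics.IsBigO.of_bound 1 (Eventually.of_forall fun v => ?_)
      rw [sub_zero, norm_pow, norm_pow, norm_norm, one_mul]
      refine pow_le_pow_left₀ (norm_nonneg _) ?_ 2
      rcases le_total v 0 with hv | hv <;> simp [hv]
    simpa using h.hasDerivAt
  · rw [max_eq_left hu.le]
    have h := hasDerivAt_pow 2 u
    refine (HasDerivAt.congr_of_eventuallyEq (f := fun v : ℝ => v ^ 2) ?_ ?_)
    · simpa using h
    · filter_upwards [Ioi_mem_nhds hu] with v hv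
      rw [max_eq_left (le_of_lt hv)]

/-! ### Initial data and the formula for β -/

section InitialDatum

variable {w₀ : ℝ → ℝ}

theorem supportEnd_eq_coe_le {a x : ℝ} (ha : supportEnd w₀ = a) (hx : 0 ≤ x) (hw : 0 < w₀ x) :
    x ≤ a := by
  have : (x : EReal) ≤ supportEnd w₀ := le_sSup ⟨x, ⟨hx, hw⟩, rfl⟩
  rw [ha] at this
  exact_mod_cast this

theorem IsInitialDatum.pos_of_lt (h : IsInitialDatum w₀) {x : ℝ} (hx : 0 ≤ x)
    (hxa : (x : EReal) < supportEnd w₀) : 0 < w₀ x := by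
  obtain ⟨_, ⟨y, ⟨hy0, hy⟩, rfl⟩, hxy⟩ := lt_sSup_iff.1 hxa
  have hxy' : x < y := EReal.coe_lt_coe_iff.1 hxy
  exact hy.trans_le (h.antitoneOn (mem_Ici.2 hx) (mem_Ici.2 hy0) hxy'.le)

theorem IsInitialDatum.zero_pos (h : IsInitialDatum w₀) : 0 < w₀ 0 := by
  by_contra hneg
  have h0 : ∀ x ∈ Ioi (0 : ℝ), w₀ x = 0 := fun x hx =>
    le_antisymm ((h.antitoneOn self_mem_Ici (mem_Ici.2 (le_of_lt hx)) (le_of_lt hx)).trans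
      (not_lt.1 hneg)) (h.nonneg x (le_of_lt hx))
  have := h.mass
  rw [setIntegral_congr_fun measurableSet_Ioi h0] at this
  simp at this

theorem IsInitialDatum.tail_eq (h : IsInitialDatum w₀) {x : ℝ} (hx : 0 ≤ x) :
    tail w₀ x = 1 - ∫ y in (0 : ℝ)..x, w₀ y := by
  have h1 : IntegrableOn w₀ (Ioc 0 x) := h.integrableOn.mono_set Ioc_subset_Ioi_self
  have h2 : IntegrableOn w₀ (Ioi x) := h.integrableOn.mono_set (Ioi_subset_Ioi hx)
  have := setIntegral_union (Ioc_disjoint_Ioi le_rfl) measurableSet_Ioi h1 h2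
  rw [Ioc_union_Ioi_eq_Ioi hx, h.mass, ← intervalIntegral.integral_of_le hx] at this
  rw [tail]; linarith

theorem IsInitialDatum.tail_zero (h : IsInitialDatum w₀) : tail w₀ 0 = 1 := h.mass

/-- Continuity of `w₀` is not part of `IsInitialDatum`; it is inherited from a solution through
`IsSolution.continuousOn_initial`. -/
theorem IsInitialDatum.hasDerivAt_tail (h : IsInitialDatum w₀)
    (hc : ContinuousOn w₀ (Ici 0)) {x : ℝ} (hx : 0 < x) :
    HasDerivAt (tail w₀) (-w₀ x) x := by
  have h1 : HasDerivAt (fun u => ∫ y in (0 : ℝ)..u, w₀ y) (w₀ x) x := by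
    refine intervalIntegral.integral_hasDerivAt_right ?_ ?_ (hc.continuousAt (Ici_mem_nhds hx))
    · rw [intervalIntegrable_iff_integrableOn_Ioc_of_le hx.le]
      exact h.integrableOn.mono_set Ioc_subset_Ioi_self
    · exact (hc.mono Ioi_subset_Ici_self).stronglyMeasurableAtFilter isOpen_Ioi x hx
  refine HasDerivAt.congr_of_eventuallyEq (h1.const_sub 1) ?_
  filter_upwards [Ioi_mem_nhds hx] with y hy using h.tail_eq (le_of_lt hy)

theorem IsInitialDatum.continuousOn_tail (h : IsInitialDatum w₀) :
    ContinuousOn (tail w₀) (Ici 0) := by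
  intro x hx
  have h1 : ContinuousOn (fun u => ∫ y in (0 : ℝ)..u, w₀ y) (uIcc 0 (x + 1)) := by
    refine intervalIntegral.continuousOn_primitive_interval ?_
    rw [uIcc_of_le (by linarith [mem_Ici.1 hx]), integrableOn_Icc_iff_integrableOn_Ioc]
    exact h.integrableOn.mono_set Ioc_subset_Ioi_self
  rw [uIcc_of_le (by linarith [mem_Ici.1 hx])] at h1
  have h2 : ContinuousWithinAt (fun u => 1 - ∫ y in (0 : ℝ)..u, w₀ y) (Icc 0 (x + 1)) x :=
    continuousWithinAt_const.sub (h1 x ⟨hx, by linarith⟩)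
  have h3 : ContinuousWithinAt (tail w₀) (Icc 0 (x + 1)) x :=
    h2.congr (fun y hy => h.tail_eq hy.1) (h.tail_eq hx)
  refine h3.mono_of_mem_nhdsWithin ?_
  rw [← Ici_inter_Iic]
  exact inter_mem self_mem_nhdsWithin (mem_nhdsWithin_of_mem_nhds (Iic_mem_nhds (by linarith)))

theorem IsInitialDatum.supportEnd_pos (h : IsInitialDatum w₀) (hc : ContinuousOn w₀ (Ici 0)) :
    0 < supportEnd w₀ := by
  have h1 : ∀ᶠ x in 𝓝[>] (0 : ℝ), 0 < w₀ x :=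
    ((hc 0 self_mem_Ici).mono Ioi_subset_Ici_self).eventually (lt_mem_nhds h.zero_pos)
  obtain ⟨x, hx, hx0⟩ := (h1.and self_mem_nhdsWithin).exists
  have : (x : EReal) ≤ supportEnd w₀ := le_sSup ⟨x, ⟨le_of_lt hx0, hx⟩, rfl⟩
  exact lt_of_lt_of_le (by exact_mod_cast hx0) this

theorem isOpen_coe_lt (a : EReal) : IsOpen {x : ℝ | (x : EReal) < a} :=
  isOpen_lt continuous_coe_real_ereal continuous_const

theorem interval_mem_nhds {a : EReal} {x : ℝ} (hx : 0 < x) (hxa : (x : EReal) < a) :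
    interval a ∈ 𝓝 x := by
  filter_upwards [Ioi_mem_nhds hx, (isOpen_coe_lt a).mem_nhds hxa] with y hy hya
  exact ⟨le_of_lt hy, hya⟩

/-- In the interior of the support, `β = -w' h / w²`. -/
theorem IsInitialDatum.hasDerivAt (h : IsInitialDatum w₀) (hc : ContinuousOn w₀ (Ici 0))
    {x : ℝ} (hx : 0 < x) (hxa : (x : EReal) < supportEnd w₀) :
    HasDerivAt w₀ (deriv w₀ x) x ∧
      beta w₀ x = -deriv w₀ x * tail w₀ x / w₀ x ^ 2 := by
  have hev : deriv (tail w₀) =ᶠ[𝓝 x] fun y => -w₀ y := by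
    filter_upwards [Ioi_mem_nhds hx] with y hy using (h.hasDerivAt_tail hc hy).deriv
  have hmem := interval_mem_nhds hx hxa
  have hC : ContDiffAt ℝ 2 (tail w₀) x := h.contDiffOn_tail.contDiffAt hmem
  have hd : DifferentiableAt ℝ (deriv (tail w₀)) x := by
    have := (hC.fderiv_right (m := 1) (by norm_num)).differentiableAt one_ne_zero
    exact this.clm_apply (differentiableAt_const (1 : ℝ))
  have hd2 : DifferentiableAt ℝ w₀ x := by
    have := (hd.congr_of_eventuallyEq hev.symm).neg
    simpa using this
  refine ⟨hd2.hasDerivAt, ?_⟩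
  have e1 : derivWithin (tail w₀) (interval (supportEnd w₀)) x = -w₀ x := by
    rw [derivWithin_of_mem_nhds hmem, (h.hasDerivAt_tail hc hx).deriv]
  have e2 : iteratedDerivWithin 2 (tail w₀) (interval (supportEnd w₀)) x = -deriv w₀ x := by
    rw [iteratedDerivWithin_succ, derivWithin_of_mem_nhds hmem]
    have : iteratedDerivWithin 1 (tail w₀) (interval (supportEnd w₀)) =ᶠ[𝓝 x]
        fun y => -w₀ y := by
      filter_upwards [Ioi_mem_nhds hx, (isOpen_coe_lt _).mem_nhds hxa] with y hy hya
      rw [iteratedDerivWithin_one, derivWithin_of_mem_nhds (interval_mem_nhds hy hya),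
        (h.hasDerivAt_tail hc hy).deriv]
    rw [this.deriv_eq, deriv.fun_neg]
  rw [beta, e1, e2, neg_sq]

end InitialDatum

/-! ### Shape of the initial data under bounds on β -/

/-- The properties of initial data with support `[0, a]` that follow from `β ≤ 1/2` on `[0, a)`
and `β > δ` on `(a - ε, a)`. -/
structure IsProfile (w₀ : ℝ → ℝ) (a ε δ : ℝ) : Prop where
  end_pos : 0 < a
  antitoneOn : AntitoneOn w₀ (Ici 0)
  eq_zero : ∀ x, a ≤ x → w₀ x = 0
  pos : ∀ x, 0 ≤ x → x < a → 0 < w₀ x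
  one_le : 1 ≤ a * w₀ 0
  le_two : a * w₀ 0 ≤ 2
  linear_le : ∀ y z, 0 ≤ y → y ≤ z → z < a → w₀ y * (a - z) ≤ w₀ z * (a - y)
  decay : ∀ y z, 0 < y → a - ε < y → y ≤ z → z < a →
    δ * w₀ z * (z - y) ≤ (w₀ y - w₀ z) * (a - y)

section

variable {w₀ : ℝ → ℝ}

/-- The quotient h/w₀ has derivative β - 1 ≤ -1/2 and stays nonnegative up to `a`. Here `a` is any
point not beyond the end of the support, so that an infinite support can be tested with large `a`.
-/
theorem IsInitialDatum.half_mul_le_tail (h : IsInitialDatum w₀) (hc : ContinuousOn w₀ (Ici 0))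
    (hβ : ∀ x ∈ interval (supportEnd w₀), beta w₀ x ≤ 1 / 2) {a : ℝ}
    (ha : (a : EReal) ≤ supportEnd w₀) {x : ℝ} (hx : 0 ≤ x) (hxa : x < a) :
    (a - x) / 2 * w₀ x ≤ tail w₀ x := by
  have hlt : ∀ y, y < a → (y : EReal) < supportEnd w₀ := fun y hy =>
    lt_of_lt_of_le (EReal.coe_lt_coe_iff.2 hy) ha
  have hpos : ∀ y ∈ Ico 0 a, 0 < w₀ y := fun y hy => h.pos_of_lt hy.1 (hlt y hy.2)
  have hder : ∀ y ∈ Ioo 0 a, HasDerivAt (fun y => tail w₀ y / w₀ y + y / 2)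
      ((-w₀ y * w₀ y - tail w₀ y * deriv w₀ y) / w₀ y ^ 2 + 1 / 2) y := fun y hy =>
    ((h.hasDerivAt_tail hc hy.1).div (h.hasDerivAt hc hy.1 (hlt y hy.2)).1
      (hpos y ⟨hy.1.le, hy.2⟩).ne').add ((hasDerivAt_id y).div_const 2)
  have hanti : AntitoneOn (fun y => tail w₀ y / w₀ y + y / 2) (Ico 0 a) := by
    refine antitoneOn_of_deriv_nonpos (convex_Ico 0 a) ?_ ?_ ?_
    · refine ContinuousOn.add (ContinuousOn.div (h.continuousOn_tail.mono Ico_subset_Ici_self)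
        (hc.mono Ico_subset_Ici_self) fun y hy => (hpos y hy).ne') (by fun_prop)
    · rw [interior_Ico]
      exact fun y hy => (hder y hy).differentiableAt.differentiableWithinAt
    · rw [interior_Ico]
      intro y hy
      have hp := hpos y ⟨hy.1.le, hy.2⟩
      have hb := hβ y ⟨hy.1.le, hlt y hy.2⟩
      rw [(h.hasDerivAt hc hy.1 (hlt y hy.2)).2, div_le_iff₀ (by positivity)] at hb
      rw [(hder y hy).deriv, div_add_div _ _ (by positivity) two_ne_zero]
      exact div_nonpos_of_nonpos_of_nonneg (by nlinarith) (by positivity)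
  have key : ∀ z ∈ Ioo x a, z / 2 ≤ tail w₀ x / w₀ x + x / 2 := by
    intro z hz
    have h1 := hanti ⟨hx, hxa⟩ ⟨hx.trans hz.1.le, hz.2⟩ hz.1.le
    have h2 : 0 ≤ tail w₀ z / w₀ z :=
      div_nonneg (setIntegral_nonneg measurableSet_Ioi fun u hu =>
        h.nonneg u (hx.trans (hz.1.le.trans (le_of_lt hu)))) (h.nonneg z (hx.trans hz.1.le))
    have h3 : tail w₀ z / w₀ z + z / 2 ≤ tail w₀ x / w₀ x + x / 2 := h1
    linarith
  have hp := hpos x ⟨hx, hxa⟩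
  have h4 : a / 2 ≤ tail w₀ x / w₀ x + x / 2 := by
    by_contra! hcon
    obtain ⟨z, hz1, hz2⟩ := exists_between (max_lt hxa (show 2 * (tail w₀ x / w₀ x + x / 2) < a by
      linarith))
    have := key z ⟨(le_max_left _ _).trans_lt hz1, hz2⟩
    linarith [(le_max_right x (2 * (tail w₀ x / w₀ x + x / 2))).trans_lt hz1]
  rw [← le_div_iff₀ hp]
  linarith

theorem IsInitialDatum.exists_supportEnd_eq (h : IsInitialDatum w₀)
    (hc : ContinuousOn w₀ (Ici 0))
    (hβ : ∀ x ∈ interval (supportEnd w₀), beta w₀ x ≤ 1 / 2) :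
    ∃ a : ℝ, 0 < a ∧ supportEnd w₀ = a := by
  have hpos := h.supportEnd_pos hc
  have htop : supportEnd w₀ ≠ ⊤ := by
    intro htop
    have h0 := h.zero_pos
    -- With this `a` the bound at 0 reads 2 ≤ 1.
    have h1 := h.half_mul_le_tail hc hβ (a := 4 / w₀ 0) (by rw [htop]; exact le_top) le_rfl
      (by positivity)
    rw [h.tail_zero, sub_zero] at h1
    field_simp at h1
    norm_num at h1
  lift supportEnd w₀ to ℝ using ⟨htop, (EReal.bot_lt_zero.trans hpos).ne'⟩ with a
  exact ⟨a, by exact_mod_cast hpos, rfl⟩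

/-- The two-sided estimate (a - x) w₀/2 ≤ h ≤ (a - x) w₀ turns the bounds on β = -w₀' h/w₀² into
bounds on w₀'. -/
theorem IsInitialDatum.isProfile (h : IsInitialDatum w₀) (hc : ContinuousOn w₀ (Ici 0))
    {a ε δ : ℝ} (ha : supportEnd w₀ = a) (hδ : 0 < δ)
    (hβ : ∀ x ∈ interval (supportEnd w₀), beta w₀ x ≤ 1 / 2)
    (hβ' : ∀ x, 0 ≤ x → a - ε < x → x < a → δ ≤ beta w₀ x) : IsProfile w₀ a ε δ := by
  have ha0 : 0 < a := by
    have := h.supportEnd_pos hc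
    rw [ha] at this
    exact_mod_cast this
  have hlt : ∀ y, y < a → (y : EReal) < supportEnd w₀ := fun y hy => by
    rw [ha]; exact EReal.coe_lt_coe_iff.2 hy
  have hpos : ∀ y, 0 ≤ y → y < a → 0 < w₀ y := fun y hy hya => h.pos_of_lt hy (hlt y hya)
  have hzero : ∀ x, a < x → w₀ x = 0 := fun x hx =>
    le_antisymm (not_lt.1 fun hw => hx.not_ge (supportEnd_eq_coe_le ha (ha0.trans hx).le hw))
      (h.nonneg x (ha0.trans hx).le)
  have hza : w₀ a = 0 := by
    have h1 : Tendsto w₀ (𝓝[>] a) (𝓝 (w₀ a)) :=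
      (hc.continuousAt (Ici_mem_nhds ha0)).tendsto.mono_left nhdsWithin_le_nhds
    have h2 : Tendsto w₀ (𝓝[>] a) (𝓝 0) :=
      tendsto_const_nhds.congr' (eventually_nhdsWithin_of_forall fun x hx => (hzero x hx).symm)
    exact tendsto_nhds_unique h1 h2
  have hzero' : ∀ x, a ≤ x → w₀ x = 0 := fun x hx => by
    rcases hx.eq_or_lt with rfl | hx
    exacts [hza, hzero x hx]
  have hlow : ∀ x, 0 ≤ x → x < a → (a - x) / 2 * w₀ x ≤ tail w₀ x := fun x hx hxa =>
    h.half_mul_le_tail hc hβ ha.ge hx hxa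
  have hup : ∀ x, 0 ≤ x → x < a → tail w₀ x ≤ (a - x) * w₀ x := by
    intro x hx hxa
    have e : tail w₀ x = ∫ y in Ioc x a, w₀ y :=
      (setIntegral_eq_of_subset_of_forall_sdiff_eq_zero measurableSet_Ioi Ioc_subset_Ioi_self
        fun y hy => hzero' y (le_of_not_ge fun hya => hy.2 ⟨hy.1, hya⟩))
    rw [e]
    have h1 : ∫ y in Ioc x a, w₀ y ≤ ∫ _ in Ioc x a, w₀ x :=
      setIntegral_mono_on (h.integrableOn.mono_set fun y hy => hx.trans_lt hy.1)
        (integrableOn_const (by simp)) measurableSet_Ioc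
        fun y hy => h.antitoneOn (mem_Ici.2 hx) (mem_Ici.2 (hx.trans hy.1.le)) hy.1.le
    refine h1.trans ?_
    simp [hxa.le]
  refine ⟨ha0, h.antitoneOn, hzero', hpos, ?_, ?_, ?_, ?_⟩
  · have := hup 0 le_rfl ha0
    rwa [h.tail_zero, sub_zero] at this
  · have := hlow 0 le_rfl ha0
    rw [h.tail_zero, sub_zero] at this
    linarith
  · have hder : ∀ y ∈ Ioo 0 a, HasDerivAt (fun y => w₀ y / (a - y))
        ((deriv w₀ y * (a - y) - w₀ y * (-1)) / (a - y) ^ 2) y := fun y hy =>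
      (h.hasDerivAt hc hy.1 (hlt y hy.2)).1.div ((hasDerivAt_id y).const_sub a)
        (sub_pos.2 hy.2).ne'
    -- What is needed is -w₀'(a - y) ≤ w₀: insert h ≥ (a - y) w₀/2 into -w₀' h ≤ w₀²/2.
    have hmono : MonotoneOn (fun y => w₀ y / (a - y)) (Ico 0 a) := by
      refine monotoneOn_of_deriv_nonneg (convex_Ico 0 a) ?_ ?_ ?_
      · exact (hc.mono Ico_subset_Ici_self).div (by fun_prop) fun y hy => (sub_pos.2 hy.2).ne'
      · rw [interior_Ico]
        exact fun y hy => (hder y hy).differentiableAt.differentiableWithinAt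
      · rw [interior_Ico]
        intro y hy
        have hp := hpos y hy.1.le hy.2
        have hb := hβ y ⟨hy.1.le, hlt y hy.2⟩
        rw [(h.hasDerivAt hc hy.1 (hlt y hy.2)).2, div_le_iff₀ (by positivity)] at hb
        rw [(hder y hy).deriv]
        refine div_nonneg ?_ (sq_nonneg _)
        have hl := hlow y hy.1.le hy.2
        by_contra! hneg
        have h1 : w₀ y < -deriv w₀ y * (a - y) := by linarith
        have h2 : 0 < -deriv w₀ y := by
          by_contra! h3
          nlinarith [sub_pos.2 hy.2]
        have h3 : -deriv w₀ y * ((a - y) / 2 * w₀ y) ≤ 1 / 2 * w₀ y ^ 2 :=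
          (mul_le_mul_of_nonneg_left hl h2.le).trans hb
        nlinarith
    intro y z hy hyz hza
    have h1 : w₀ y / (a - y) ≤ w₀ z / (a - z) :=
      hmono ⟨hy, hyz.trans_lt hza⟩ ⟨hy.trans hyz, hza⟩ hyz
    rwa [div_le_div_iff₀ (by linarith) (by linarith)] at h1
  · intro y z hy hya hyz hza
    rcases hyz.eq_or_lt with rfl | hyz
    · simp
    -- At the mean value point, β ≥ δ and h ≤ (a - ξ) w₀ give -w₀'(a - ξ) ≥ δ w₀; monotonicity then
    -- replaces w₀(ξ) by w₀(z) and a - ξ by a - y.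
    obtain ⟨ξ, hξ, hd⟩ := exists_deriv_eq_slope w₀ hyz
      (hc.mono fun u hu => hy.le.trans hu.1)
      (fun u hu => (h.hasDerivAt hc (hy.trans hu.1)
        (hlt u (hu.2.trans hza))).1.differentiableAt.differentiableWithinAt)
    have hξ0 := hy.trans hξ.1
    have hξa := hξ.2.trans hza
    have hp := hpos ξ hξ0.le hξa
    have hb := hβ' ξ hξ0.le (hya.trans hξ.1) hξa
    rw [(h.hasDerivAt hc hξ0 (hlt ξ hξa)).2, le_div_iff₀ (by positivity)] at hb
    have hd' : w₀ z - w₀ y = deriv w₀ ξ * (z - y) := by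
      rw [hd]; field_simp [(sub_pos.2 hyz).ne']
    have hu := hup ξ hξ0.le hξa
    have hn : 0 ≤ -deriv w₀ ξ := by
      by_contra! h3
      have ht : 0 ≤ tail w₀ ξ := le_trans (by nlinarith) (hlow ξ hξ0.le hξa)
      have : 0 < δ * w₀ ξ ^ 2 := by positivity
      nlinarith
    have h4 : δ * w₀ ξ ^ 2 ≤ -deriv w₀ ξ * ((a - ξ) * w₀ ξ) :=
      hb.trans (mul_le_mul_of_nonneg_left hu hn)
    have h5 : δ * w₀ ξ ≤ -deriv w₀ ξ * (a - ξ) := by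
      by_contra! h6
      nlinarith
    have h7 : δ * w₀ z ≤ -deriv w₀ ξ * (a - y) := by
      have := h.antitoneOn (mem_Ici.2 hξ0.le) (mem_Ici.2 (hξ0.trans hξ.2).le) hξ.2.le
      nlinarith [hξ.1, mul_nonneg hn (sub_nonneg.2 hξ.1.le)]
    nlinarith [mul_le_mul_of_nonneg_right h7 (sub_nonneg.2 hyz.le)]

end

/-! ### Characteristics in the cube-root coordinate -/

/-- Squared positive parts are differentiable, so monotonicity of such a function proves a barrier
statement without discussing first exit times. -/
theorem hasDerivAt_max_zero_sq_comp {f : ℝ → ℝ} {f' s : ℝ} (hf : HasDerivAt f f' s) :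
    HasDerivAt (fun s => (max (f s) 0) ^ 2) (2 * max (f s) 0 * f') s :=
  (hasDerivAt_max_zero_sq (f s)).comp s hf

theorem continuousOn_max_zero_sq {f : ℝ → ℝ} {S : Set ℝ} (hf : ContinuousOn f S) :
    ContinuousOn (fun s => (max (f s) 0) ^ 2) S :=
  (hf.sup continuousOn_const).pow 2

/-- A characteristic curve `x = p³` of the transport equation on the time interval `[0, T]`, where
`l = L^{1/3}`. -/
structure IsChar (l : ℝ → ℝ) (T : ℝ) (p : ℝ → ℝ) : Prop where
  continuousOn : ContinuousOn p (Icc 0 T)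
  pos : ∀ s ∈ Icc 0 T, 0 < p s
  hasDerivAt : ∀ s ∈ Ioo 0 T, HasDerivAt p ((-1 + p s / l s) / (3 * p s ^ 2)) s

theorem IsChar.hasDerivAt_cube {l p : ℝ → ℝ} {T s : ℝ} (h : IsChar l T p) (hs : s ∈ Ioo 0 T) :
    HasDerivAt (fun s => p s ^ 3) (-1 + p s / l s) s := by
  have hp := h.pos s (Ioo_subset_Icc_self hs)
  refine ((h.hasDerivAt s hs).pow 3).congr_deriv ?_
  field_simp
  norm_num
  ring

/-- The characteristic is traced back from its end point. The field is singular at p = 0, so 1/p is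
truncated below the level e = min(q, min l) and Picard–Lindelöf applies on all of [0, T]; the
solution found never goes below e, hence solves the original equation. -/
theorem IsChar.exists_of_continuousOn {l : ℝ → ℝ} {T q : ℝ} (hT : 0 ≤ T) (hq : 0 < q)
    (hl : ContinuousOn l (Icc 0 T)) (hpos : ∀ s ∈ Icc 0 T, 0 < l s) :
    ∃ p, IsChar l T p ∧ p T = q := by
  obtain ⟨t₁, ht₁, hmin⟩ := isCompact_Icc.exists_isMinOn (nonempty_Icc.2 hT) hl
  set m := l t₁ with hm
  have hm0 : 0 < m := hpos t₁ ht₁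
  have hml : ∀ s ∈ Icc 0 T, m ≤ l s := fun s hs => hmin hs
  set e := min q m with he
  have he0 : 0 < e := lt_min hq hm0
  set i : ℝ → ℝ := fun x => (max x e)⁻¹ with hi
  have hmax : ∀ x, e ≤ max x e := fun x => le_max_right _ _
  have hi0 : ∀ x, 0 < i x := fun x => inv_pos.2 (he0.trans_le (hmax x))
  have hie : ∀ x, i x ≤ e⁻¹ := fun x => inv_anti₀ he0 (hmax x)
  have hil : ∀ x y, |i x - i y| ≤ e⁻¹ ^ 2 * |x - y| := by
    intro x y
    have h1 : i x - i y = (i x * i y) * (max y e - max x e) := by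
      simp only [hi]
      field_simp [(he0.trans_le (hmax x)).ne', (he0.trans_le (hmax y)).ne']
    rw [h1, abs_mul, abs_of_pos (mul_pos (hi0 x) (hi0 y))]
    have h2 : |max y e - max x e| ≤ |x - y| := by
      rw [abs_sub_comm x y]; exact abs_max_sub_max_le_abs y x e
    have h3 : i x * i y ≤ e⁻¹ ^ 2 := by
      rw [sq]; exact mul_le_mul (hie x) (hie y) (hi0 y).le (inv_pos.2 he0).le
    exact mul_le_mul h3 h2 (abs_nonneg _) (by positivity)
  set f : ℝ → ℝ → ℝ := fun t x => i x * (3 * l t)⁻¹ - i x ^ 2 / 3 with hf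
  have hlinv : ∀ s ∈ Icc 0 T, 0 < (3 * l s)⁻¹ ∧ (3 * l s)⁻¹ ≤ (3 * m)⁻¹ := fun s hs =>
    ⟨inv_pos.2 (mul_pos three_pos (hpos s hs)), inv_anti₀ (by positivity) (by linarith [hml s hs])⟩
  set B : ℝ := e⁻¹ * (3 * m)⁻¹ + e⁻¹ ^ 2 / 3 with hB
  set K : ℝ := ((3 * m)⁻¹ + 2 * e⁻¹ / 3) * e⁻¹ ^ 2 with hK
  have hB0 : 0 ≤ B := by positivity
  have hK0 : 0 ≤ K := by positivity
  have hpl : IsPicardLindelof f (⟨T, hT, le_rfl⟩ : Icc 0 T) q ⟨B * T, by positivity⟩ 0 ⟨B, hB0⟩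
      ⟨K, hK0⟩ := by
    refine ⟨fun t ht => ?_, fun x _ => ?_, fun t ht x _ => ?_, ?_⟩
    · refine LipschitzOnWith.of_dist_le_mul fun x _ y _ => ?_
      rw [Real.dist_eq, Real.dist_eq]
      change |f t x - f t y| ≤ K * |x - y|
      have h1 : f t x - f t y = ((3 * l t)⁻¹ - (i x + i y) / 3) * (i x - i y) := by
        simp only [hf]; ring
      rw [h1, abs_mul, hK, mul_assoc]
      refine mul_le_mul ?_ (hil x y) (abs_nonneg _) (by positivity)
      have := hlinv t ht
      rw [abs_le]
      constructor <;> linarith [hi0 x, hi0 y, hie x, hie y]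
    · exact (continuousOn_const.mul ((continuousOn_const.mul hl).inv₀ fun s hs =>
        (mul_pos three_pos (hpos s hs)).ne')).sub continuousOn_const
    · have := hlinv t ht
      change |f t x| ≤ B
      have h1 : i x * (3 * l t)⁻¹ ≤ e⁻¹ * (3 * m)⁻¹ :=
        mul_le_mul (hie x) this.2 this.1.le (inv_pos.2 he0).le
      have h2 : i x ^ 2 ≤ e⁻¹ ^ 2 := pow_le_pow_left₀ (hi0 x).le (hie x) 2
      have h3 : 0 < i x * (3 * l t)⁻¹ := mul_pos (hi0 x) this.1
      have h4 : 0 < e⁻¹ * (3 * m)⁻¹ := by positivity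
      rw [abs_le]
      constructor <;> simp only [hf, hB] <;> nlinarith [sq_nonneg (i x)]
    · change B * max (T - T) (T - 0) ≤ B * T - 0
      simp [hT]
  obtain ⟨p, hpT, hp⟩ := hpl.exists_eq_forall_mem_Icc_hasDerivWithinAt₀
  change p T = q at hpT
  have hcont : ContinuousOn p (Icc 0 T) := fun s hs => (hp s hs).continuousWithinAt
  have hder : ∀ s ∈ Ioo 0 T, HasDerivAt p (f s (p s)) s := fun s hs =>
    (hp s (Ioo_subset_Icc_self hs)).hasDerivAt (Icc_mem_nhds hs.1 hs.2)
  -- Below e ≤ l the truncated field points downwards, so a solution below e stays there; this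
  -- contradicts p(T) = q ≥ e.
  have hmono : MonotoneOn (fun s => (max (e - p s) 0) ^ 2) (Icc 0 T) := by
    have hd : ∀ s ∈ Ioo 0 T, HasDerivAt (fun s => (max (e - p s) 0) ^ 2)
        (2 * max (e - p s) 0 * (-f s (p s))) s := fun s hs =>
      hasDerivAt_max_zero_sq_comp ((hder s hs).const_sub e)
    refine monotoneOn_of_deriv_nonneg (convex_Icc 0 T) ?_ ?_ ?_
    · exact continuousOn_max_zero_sq (continuousOn_const.sub hcont)
    · rw [interior_Icc]
      exact fun s hs => (hd s hs).differentiableAt.differentiableWithinAt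
    · rw [interior_Icc]
      intro s hs
      rw [(hd s hs).deriv]
      rcases le_or_gt e (p s) with hle | hlt
      · rw [max_eq_right (by linarith)]; simp
      · refine mul_nonneg (by positivity) ?_
        have hl0 := hpos s (Ioo_subset_Icc_self hs)
        have h1 : i (p s) = e⁻¹ := by simp only [hi, max_eq_right hlt.le]
        have h2 : (l s)⁻¹ ≤ e⁻¹ :=
          inv_anti₀ he0 ((min_le_right q m).trans (hml s (Ioo_subset_Icc_self hs)))
        simp only [hf, h1, mul_inv]
        nlinarith [mul_le_mul_of_nonneg_left h2 (inv_pos.2 he0).le]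
  have hpe : ∀ s ∈ Icc 0 T, e ≤ p s := by
    intro s hs
    have h1 : (max (e - p s) 0) ^ 2 ≤ (max (e - p T) 0) ^ 2 := hmono hs (right_mem_Icc.2 hT) hs.2
    rw [hpT, max_eq_right (a := e - q) (by linarith [min_le_left q m])] at h1
    by_contra! hlt
    rw [max_eq_left (by linarith)] at h1
    nlinarith
  refine ⟨p, ⟨hcont, fun s hs => he0.trans_le (hpe s hs), fun s hs => ?_⟩, hpT⟩
  have h1 := hpe s (Ioo_subset_Icc_self hs)
  have h2 := he0.trans_le h1
  have h3 := hpos s (Ioo_subset_Icc_self hs)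
  refine (hder s hs).congr_deriv ?_
  simp only [hf, hi, max_eq_left h1]
  field_simp
  ring

/-- Grönwall: D = r³ - p³ satisfies D' = D/(l(r² + rp + p²)) with a bounded coefficient, so D ≤ 0 at
one time persists up to `T`. -/
theorem IsChar.lt_of_lt {l p r : ℝ → ℝ} {T : ℝ} (hp : IsChar l T p) (hr : IsChar l T r)
    (hl : ContinuousOn l (Icc 0 T)) (hpos : ∀ s ∈ Icc 0 T, 0 < l s) (h : p T < r T) :
    ∀ s ∈ Icc 0 T, p s < r s := by
  intro s₀ hs₀
  have hT : T ∈ Icc 0 T := ⟨hs₀.1.trans hs₀.2, le_rfl⟩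
  have hg : ContinuousOn (fun s => (l s * (r s ^ 2 + r s * p s + p s ^ 2))⁻¹) (Icc 0 T) := by
    refine ContinuousOn.inv₀ (hl.mul (((hr.continuousOn.pow 2).add
      (hr.continuousOn.mul hp.continuousOn)).add (hp.continuousOn.pow 2))) fun s hs => ?_
    have := hp.pos s hs
    have := hr.pos s hs
    have := hpos s hs
    positivity
  obtain ⟨K, hK⟩ := isCompact_Icc.bddAbove_image hg
  have hK : ∀ s ∈ Icc 0 T, (l s * (r s ^ 2 + r s * p s + p s ^ 2))⁻¹ ≤ K := fun s hs =>
    hK (mem_image_of_mem _ hs)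
  by_contra! hle
  have hanti : AntitoneOn (fun s => (max (r s ^ 3 - p s ^ 3) 0) ^ 2 * Real.exp (-(2 * K) * s))
      (Icc s₀ T) := by
    have hd : ∀ s ∈ Ioo s₀ T, HasDerivAt
        (fun s => (max (r s ^ 3 - p s ^ 3) 0) ^ 2 * Real.exp (-(2 * K) * s))
        (2 * max (r s ^ 3 - p s ^ 3) 0 * ((-1 + r s / l s) - (-1 + p s / l s)) *
          Real.exp (-(2 * K) * s) + (max (r s ^ 3 - p s ^ 3) 0) ^ 2 *
          (Real.exp (-(2 * K) * s) * (-(2 * K) * 1))) s := by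
      intro s hs
      have hs' : s ∈ Ioo 0 T := ⟨hs₀.1.trans_lt hs.1, hs.2⟩
      exact (hasDerivAt_max_zero_sq_comp
        ((hr.hasDerivAt_cube hs').sub (hp.hasDerivAt_cube hs'))).mul
          (((hasDerivAt_id s).const_mul _).exp)
    have hsub : Icc s₀ T ⊆ Icc 0 T := Icc_subset_Icc_left hs₀.1
    refine antitoneOn_of_deriv_nonpos (convex_Icc s₀ T) ?_ ?_ ?_
    · refine ContinuousOn.mul (continuousOn_max_zero_sq ?_) (by fun_prop)
      exact ((hr.continuousOn.pow 3).sub (hp.continuousOn.pow 3)).mono hsub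
    · rw [interior_Icc]
      exact fun s hs => (hd s hs).differentiableAt.differentiableWithinAt
    · rw [interior_Icc]
      intro s hs
      rw [(hd s hs).deriv]
      rcases le_or_gt (r s ^ 3 - p s ^ 3) 0 with hD | hD
      · rw [max_eq_right hD]; simp
      · rw [max_eq_left hD.le]
        have hs' : s ∈ Icc 0 T := hsub (Ioo_subset_Icc_self hs)
        have h1 := hp.pos s hs'
        have h2 := hr.pos s hs'
        have h3 := hpos s hs'
        have h4 : (-1 + r s / l s) - (-1 + p s / l s) =
            (l s * (r s ^ 2 + r s * p s + p s ^ 2))⁻¹ * (r s ^ 3 - p s ^ 3) := by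
          field_simp
          ring
        have h5 := mul_le_mul_of_nonneg_right (hK s hs') (sq_nonneg (r s ^ 3 - p s ^ 3))
        rw [h4]
        have h6 : 0 < Real.exp (-(2 * K) * s) := Real.exp_pos _
        have h7 := mul_le_mul_of_nonneg_right h5 h6.le
        nlinarith
  have h1 : (max (r T ^ 3 - p T ^ 3) 0) ^ 2 * Real.exp (-(2 * K) * T) ≤
      (max (r s₀ ^ 3 - p s₀ ^ 3) 0) ^ 2 * Real.exp (-(2 * K) * s₀) :=
    hanti ⟨le_rfl, hs₀.2⟩ ⟨hs₀.2, le_rfl⟩ hs₀.2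
  have h2 : r s₀ ^ 3 - p s₀ ^ 3 ≤ 0 :=
    sub_nonpos.2 (pow_le_pow_left₀ (hr.pos s₀ hs₀).le hle 3)
  have h3 : 0 < r T ^ 3 - p T ^ 3 :=
    sub_pos.2 (pow_lt_pow_left₀ h (hp.pos T hT).le three_ne_zero)
  rw [max_eq_left h3.le, max_eq_right h2] at h1
  have : 0 < (r T ^ 3 - p T ^ 3) ^ 2 * Real.exp (-(2 * K) * T) := by positivity
  simp only [ne_eq, OfNat.ofNat_ne_zero, not_false_eq_true, zero_pow, zero_mul] at h1
  linarith

/-! ### Regularity of the scale, and transport along characteristics -/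

/-- The cube root of the parameter `L(t)`. -/
noncomputable def scaleRoot (w : ℝ → ℝ → ℝ) (t : ℝ) : ℝ :=
  (1 / 3 : ℝ) * (∫ x in Ioi (0 : ℝ), x ^ (-(2 / 3) : ℝ) * w x t) / w 0 t

theorem scale_eq (w : ℝ → ℝ → ℝ) (t : ℝ) : scale w t = scaleRoot w t ^ 3 := rfl

section Solution

variable {w₀ : ℝ → ℝ} {w : ℝ → ℝ → ℝ}

theorem IsSolution.continuousOn_space (h : IsSolution w₀ w) {t : ℝ} (ht : 0 ≤ t) :
    ContinuousOn (fun x => w x t) (Ici 0) :=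
  h.continuousOn.comp (f := fun x : ℝ => (x, t)) (by fun_prop) fun _ hx => ⟨hx, ht⟩

theorem IsSolution.continuousOn_time (h : IsSolution w₀ w) {x : ℝ} (hx : 0 ≤ x) :
    ContinuousOn (fun t => w x t) (Ici 0) :=
  h.continuousOn.comp (f := fun t : ℝ => (x, t)) (by fun_prop) fun _ ht => ⟨hx, ht⟩

theorem IsSolution.continuousOn_initial (h : IsSolution w₀ w) : ContinuousOn w₀ (Ici 0) :=
  (h.continuousOn_space le_rfl).congr fun x hx => (h.initial x hx).symm

theorem IsSolution.zero_pos (h : IsSolution w₀ w) {t : ℝ} (ht : 0 ≤ t) : 0 < w 0 t := by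
  by_contra hneg
  have h0 : ∀ x ∈ Ioi (0 : ℝ), w x t = 0 := fun x hx =>
    le_antisymm ((h.antitoneOn t ht self_mem_Ici (mem_Ici.2 (le_of_lt hx)) (le_of_lt hx)).trans
      (not_lt.1 hneg)) (h.nonneg x t (le_of_lt hx) ht)
  have := h.mass t ht
  rw [setIntegral_congr_fun measurableSet_Ioi h0] at this
  simp at this

theorem IsSolution.mul_le_one (h : IsSolution w₀ w) {x t : ℝ} (hx : 0 ≤ x) (ht : 0 ≤ t) :
    x * w x t ≤ 1 := by
  have h1 : ∫ _ in Ioc 0 x, w x t ≤ ∫ y in Ioc 0 x, w y t :=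
    setIntegral_mono_on (integrableOn_const (by simp))
      ((h.integrableOn t ht).mono_set Ioc_subset_Ioi_self) measurableSet_Ioc
      fun y hy => h.antitoneOn t ht (mem_Ici.2 hy.1.le) (mem_Ici.2 hx) hy.2
  have h2 : ∫ y in Ioc 0 x, w y t ≤ ∫ y in Ioi 0, w y t :=
    setIntegral_mono_set (h.integrableOn t ht)
      ((ae_restrict_mem measurableSet_Ioi).mono fun y hy => h.nonneg y t (le_of_lt hy) ht)
      Ioc_subset_Ioi_self.eventuallyLE
  rw [h.mass t ht] at h2
  simp [hx] at h1
  exact h1.trans h2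

/-- An integrable majorant of `x ^ (-2/3) * w x t` for `w 0 t ≤ M`. -/
noncomputable def majorant (M x : ℝ) : ℝ :=
  (Ioc (0 : ℝ) 1).indicator (fun x => x ^ (-(2 / 3) : ℝ) * M) x +
    (Ioi (1 : ℝ)).indicator (fun x => x ^ (-(5 / 3) : ℝ)) x

theorem integrableOn_majorant (M : ℝ) : IntegrableOn (majorant M) (Ioi 0) := by
  refine Integrable.integrableOn ?_
  refine Integrable.add ?_ ?_
  · rw [integrable_indicator_iff measurableSet_Ioc]
    refine Integrable.mul_const ?_ M
    change IntegrableOn _ _ volume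
    rw [← intervalIntegrable_iff_integrableOn_Ioc_of_le zero_le_one]
    exact intervalIntegral.intervalIntegrable_rpow' (by norm_num)
  · rw [integrable_indicator_iff measurableSet_Ioi]
    exact integrableOn_Ioi_rpow_of_lt (by norm_num) one_pos

theorem IsSolution.norm_le_majorant (h : IsSolution w₀ w) {x t M : ℝ} (hx : 0 < x) (ht : 0 ≤ t)
    (hM : w 0 t ≤ M) : ‖x ^ (-(2 / 3) : ℝ) * w x t‖ ≤ majorant M x := by
  have hw := h.nonneg x t hx.le ht
  have hr : 0 ≤ x ^ (-(2 / 3) : ℝ) := Real.rpow_nonneg hx.le _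
  rw [Real.norm_of_nonneg (mul_nonneg hr hw), majorant]
  rcases le_or_gt x 1 with h1 | h1
  · rw [indicator_of_mem (show x ∈ Ioc (0 : ℝ) 1 from ⟨hx, h1⟩),
      indicator_of_notMem (show x ∉ Ioi (1 : ℝ) from not_lt.2 h1), add_zero]
    exact mul_le_mul_of_nonneg_left ((h.antitoneOn t ht self_mem_Ici (mem_Ici.2 hx.le) hx.le).trans
      hM) hr
  · rw [indicator_of_notMem (show x ∉ Ioc (0 : ℝ) 1 from fun hh => h1.not_ge hh.2),
      indicator_of_mem (show x ∈ Ioi (1 : ℝ) from h1), zero_add]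
    have h2 : w x t ≤ x⁻¹ := by
      rw [← one_div, le_div_iff₀ hx, mul_comm]; exact h.mul_le_one hx.le ht
    have h3 : x ^ (-(5 / 3) : ℝ) = x ^ (-(2 / 3) : ℝ) * x⁻¹ := by
      rw [← Real.rpow_neg_one x, ← Real.rpow_add hx]; norm_num
    rw [h3]
    exact mul_le_mul_of_nonneg_left h2 hr

theorem IsSolution.aestronglyMeasurable (h : IsSolution w₀ w) {t : ℝ} (ht : 0 ≤ t) :
    AEStronglyMeasurable (fun x => x ^ (-(2 / 3) : ℝ) * w x t) (volume.restrict (Ioi 0)) := by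
  refine ContinuousOn.aestronglyMeasurable ?_ measurableSet_Ioi
  refine ContinuousOn.mul ?_ ((h.continuousOn_space ht).mono Ioi_subset_Ici_self)
  exact fun x hx => (Real.continuousAt_rpow_const x _ (Or.inl (ne_of_gt hx))).continuousWithinAt

theorem IsSolution.integrableOn_rpow_mul (h : IsSolution w₀ w) {t : ℝ} (ht : 0 ≤ t) :
    IntegrableOn (fun x => x ^ (-(2 / 3) : ℝ) * w x t) (Ioi 0) :=
  (integrableOn_majorant (w 0 t)).mono' (h.aestronglyMeasurable ht)
    ((ae_restrict_mem measurableSet_Ioi).mono fun _ hx => h.norm_le_majorant hx ht le_rfl)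

/-- Dominated convergence: w(0,·) is bounded on [0, T], which controls small x, and mass one gives w
≤ 1/x for large x. -/
theorem IsSolution.continuousOn_scaleRoot (h : IsSolution w₀ w) (T : ℝ) :
    ContinuousOn (scaleRoot w) (Icc 0 T) := by
  obtain ⟨M, hM⟩ := isCompact_Icc.bddAbove_image
    ((h.continuousOn_time le_rfl).mono (Icc_subset_Ici_self : Icc 0 T ⊆ Ici 0))
  refine ContinuousOn.div (continuousOn_const.mul ?_)
    ((h.continuousOn_time le_rfl).mono Icc_subset_Ici_self) fun s hs => (h.zero_pos hs.1).ne'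
  refine MeasureTheory.continuousOn_of_dominated (fun t ht => h.aestronglyMeasurable ht.1)
    (fun t ht => (ae_restrict_mem measurableSet_Ioi).mono fun x hx =>
      h.norm_le_majorant hx ht.1 (hM (mem_image_of_mem _ ht))) (integrableOn_majorant M) ?_
  exact (ae_restrict_mem measurableSet_Ioi).mono fun x hx =>
    continuousOn_const.mul ((h.continuousOn_time (le_of_lt hx)).mono Icc_subset_Ici_self)

theorem IsSolution.scaleRoot_pos (h : IsSolution w₀ w) {t : ℝ} (ht : 0 ≤ t) :
    0 < scaleRoot w t := by
  refine div_pos (mul_pos (by norm_num) ?_) (h.zero_pos ht)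
  have h0 : ∀ x ∈ Ioi (0 : ℝ), 0 ≤ x ^ (-(2 / 3) : ℝ) * w x t := fun x hx =>
    mul_nonneg (Real.rpow_nonneg (le_of_lt hx) _) (h.nonneg x t (le_of_lt hx) ht)
  refine (setIntegral_nonneg measurableSet_Ioi h0).lt_of_ne' fun hzero => ?_
  rw [setIntegral_eq_zero_iff_of_nonneg_ae ((ae_restrict_mem measurableSet_Ioi).mono h0)
    (h.integrableOn_rpow_mul ht)] at hzero
  have h1 : (fun x => w x t) =ᵐ[volume.restrict (Ioi 0)] 0 := by
    filter_upwards [hzero, ae_restrict_mem measurableSet_Ioi] with x hx hx0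
    exact (mul_eq_zero.1 hx).resolve_left (Real.rpow_pos_of_pos hx0 _).ne'
  have := h.mass t ht
  rw [integral_congr_ae h1] at this
  simp at this

theorem IsSolution.exists_isChar (h : IsSolution w₀ w) {T q : ℝ} (hT : 0 ≤ T) (hq : 0 < q) :
    ∃ p, IsChar (scaleRoot w) T p ∧ p T = q :=
  IsChar.exists_of_continuousOn hT hq (h.continuousOn_scaleRoot T) fun _ hs => h.scaleRoot_pos hs.1

theorem IsSolution.transport_scaleRoot (h : IsSolution w₀ w) {p t : ℝ} (hp : 0 < p) (ht : 0 < t)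
    (hw : 0 < w (p ^ 3) t) :
    deriv (fun s => w (p ^ 3) s) t
      = (1 - p / scaleRoot w t) * deriv (fun y => w y t) (p ^ 3) := by
  rw [h.transport _ t (by positivity) ht hw, scale_eq, ← div_pow]
  have h0 : 0 ≤ p / scaleRoot w t := (div_pos hp (h.scaleRoot_pos ht.le)).le
  have : ((p / scaleRoot w t) ^ 3) ^ (1 / 3 : ℝ) = p / scaleRoot w t := by
    have := Real.pow_rpow_inv_natCast h0 three_ne_zero
    rwa [← one_div] at this
  rw [this]

theorem IsSolution.hasDerivAt_space (h : IsSolution w₀ w) {x t : ℝ} (hx : 0 < x) (ht : 0 < t)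
    (hw : 0 < w x t) : HasDerivAt (fun y => w y t)
      (fderiv ℝ (fun p : ℝ × ℝ => w p.1 p.2) (x, t) (1, 0)) x :=
  (h.differentiableAt x t hx ht hw).hasFDerivAt.comp_hasDerivAt (f := fun y : ℝ => (y, t)) x
    ((hasDerivAt_id x).prodMk (hasDerivAt_const x t))

theorem IsSolution.hasDerivAt_time (h : IsSolution w₀ w) {x t : ℝ} (hx : 0 < x) (ht : 0 < t)
    (hw : 0 < w x t) : HasDerivAt (fun s => w x s)
      (fderiv ℝ (fun p : ℝ × ℝ => w p.1 p.2) (x, t) (0, 1)) t :=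
  (h.differentiableAt x t hx ht hw).hasFDerivAt.comp_hasDerivAt (f := fun s : ℝ => (x, s)) t
    ((hasDerivAt_const t x).prodMk (hasDerivAt_id t))

theorem IsSolution.hasDerivAt_char (h : IsSolution w₀ w) {T : ℝ} {p : ℝ → ℝ}
    (hp : IsChar (scaleRoot w) T p) {s : ℝ} (hs : s ∈ Ioo 0 T) (hw : 0 < w (p s ^ 3) s) :
    HasDerivAt (fun s => w (p s ^ 3) s) 0 s := by
  have hps := hp.pos s (Ioo_subset_Icc_self hs)
  have hx : 0 < p s ^ 3 := by positivity
  have h1 := (h.differentiableAt _ s hx hs.1 hw).hasFDerivAt.comp_hasDerivAt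
    (f := fun s : ℝ => (p s ^ 3, s)) s ((hp.hasDerivAt_cube hs).prodMk (hasDerivAt_id s))
  refine h1.congr_deriv ?_
  have h2 := h.transport_scaleRoot hps hs.1 hw
  rw [(h.hasDerivAt_time hx hs.1 hw).deriv, (h.hasDerivAt_space hx hs.1 hw).deriv] at h2
  have h3 : ((-1 + p s / scaleRoot w s, 1) : ℝ × ℝ) =
      (-1 + p s / scaleRoot w s) • ((1, 0) : ℝ × ℝ) + (0, 1) := by simp
  rw [h3, map_add, map_smul, h2, smul_eq_mul]
  ring

/-- The equation is only available where w > 0, and positivity along the curve is not known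
beforehand. Truncating at half the terminal value gives a function that is locally constant where w
≤ 0 and has zero derivative where w > 0, hence is constant. -/
theorem IsSolution.eq_of_isChar (h : IsSolution w₀ w) {T : ℝ} {p : ℝ → ℝ}
    (hp : IsChar (scaleRoot w) T p) (hw : 0 < w (p T ^ 3) T) {s : ℝ} (hs : s ∈ Icc 0 T) :
    w (p s ^ 3) s = w (p T ^ 3) T := by
  set c := w (p T ^ 3) T with hc
  have hT : T ∈ Icc 0 T := ⟨hs.1.trans hs.2, le_rfl⟩
  have hcont : ContinuousOn (fun s => w (p s ^ 3) s) (Icc 0 T) :=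
    h.continuousOn.comp (f := fun s : ℝ => (p s ^ 3, s))
      ((hp.continuousOn.pow 3).prodMk continuousOn_id)
      fun u hu => ⟨(pow_pos (hp.pos u hu) 3).le, hu.1⟩
  have hcont2 : ContinuousOn (fun s => (max (w (p s ^ 3) s - c / 2) 0) ^ 2) (Icc 0 T) :=
    continuousOn_max_zero_sq (hcont.sub continuousOn_const)
  have hd : ∀ u ∈ Ioo 0 T, HasDerivAt (fun s => (max (w (p s ^ 3) s - c / 2) 0) ^ 2) 0 u := by
    intro u hu
    rcases le_or_gt (w (p u ^ 3) u) 0 with hle | hlt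
    · refine (hasDerivAt_const u (0 : ℝ)).congr_of_eventuallyEq ?_
      have : ∀ᶠ v in 𝓝 u, w (p v ^ 3) v < c / 2 :=
        (hcont.continuousAt (Icc_mem_nhds hu.1 hu.2)).eventually_lt_const (by linarith)
      filter_upwards [this] with v hv
      rw [max_eq_right (by linarith)]; simp
    · have := hasDerivAt_max_zero_sq_comp ((h.hasDerivAt_char hp hu hlt).sub_const (c / 2))
      simpa using this
  have hmono : MonotoneOn (fun s => (max (w (p s ^ 3) s - c / 2) 0) ^ 2) (Icc 0 T) := by
    refine monotoneOn_of_deriv_nonneg (convex_Icc 0 T) hcont2 ?_ ?_ <;> rw [interior_Icc]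
    · exact fun u hu => (hd u hu).differentiableAt.differentiableWithinAt
    · exact fun u hu => (hd u hu).deriv.ge
  have hanti : AntitoneOn (fun s => (max (w (p s ^ 3) s - c / 2) 0) ^ 2) (Icc 0 T) := by
    refine antitoneOn_of_deriv_nonpos (convex_Icc 0 T) hcont2 ?_ ?_ <;> rw [interior_Icc]
    · exact fun u hu => (hd u hu).differentiableAt.differentiableWithinAt
    · exact fun u hu => (hd u hu).deriv.le
  have heq : (max (w (p s ^ 3) s - c / 2) 0) ^ 2 = (max (c - c / 2) 0) ^ 2 :=
    le_antisymm (hmono hs hT hs.2) (hanti hs hT hs.2)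
  have h1 := (pow_left_inj₀ (le_max_right _ _) (le_max_right _ _) two_ne_zero).1 heq
  rw [max_eq_left (a := c - c / 2) (by linarith)] at h1
  rcases max_cases (w (p s ^ 3) s - c / 2) 0 with h2 | h2 <;> linarith

end Solution

/-! ### Comparison of characteristics -/

section Comparison

variable {l p r P : ℝ → ℝ} {T : ℝ}

theorem IsChar.continuousOn_cube (hp : IsChar l T p) :
    ContinuousOn (fun s => p s ^ 3) (Icc 0 T) := hp.continuousOn.pow 3

theorem IsChar.cube_pos (hp : IsChar l T p) {s : ℝ} (hs : s ∈ Icc 0 T) : 0 < p s ^ 3 :=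
  pow_pos (hp.pos s hs) 3

theorem IsChar.cube_lt (hp : IsChar l T p) {s : ℝ} (hs : s ∈ Icc 0 T) (h : p s < r s) :
    0 < r s ^ 3 - p s ^ 3 :=
  sub_pos.2 (pow_lt_pow_left₀ h (hp.pos s hs).le three_ne_zero)

theorem IsChar.hasDerivAt_cube_sub (hp : IsChar l T p) (hr : IsChar l T r) {s : ℝ}
    (hs : s ∈ Ioo 0 T) : HasDerivAt (fun s => r s ^ 3 - p s ^ 3) ((r s - p s) / l s) s :=
  ((hr.hasDerivAt_cube hs).sub (hp.hasDerivAt_cube hs)).congr_deriv (by ring)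

/-- The flow of the transport equation is concave. -/
theorem IsChar.concave (hT : 0 ≤ T) (hp : IsChar l T p) (hr : IsChar l T r) (hP : IsChar l T P)
    (hl : ContinuousOn l (Icc 0 T)) (hpos : ∀ s ∈ Icc 0 T, 0 < l s) (hpr : p T < r T)
    (hrP : r T < P T) :
    (P T ^ 3 - r T ^ 3) / (P T ^ 3 - p T ^ 3) ≤ (P 0 ^ 3 - r 0 ^ 3) / (P 0 ^ 3 - p 0 ^ 3) := by
  have hpr' := hp.lt_of_lt hr hl hpos hpr
  have hrP' := hr.lt_of_lt hP hl hpos hrP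
  have hM : ∀ s ∈ Icc 0 T, 0 < P s ^ 3 - p s ^ 3 := fun s hs =>
    hp.cube_lt hs ((hpr' s hs).trans (hrP' s hs))
  have hd : ∀ s ∈ Ioo 0 T, HasDerivAt (fun s => (P s ^ 3 - r s ^ 3) / (P s ^ 3 - p s ^ 3)) _ s :=
    fun s hs => (hr.hasDerivAt_cube_sub hP hs).div (hp.hasDerivAt_cube_sub hP hs)
      (hM s (Ioo_subset_Icc_self hs)).ne'
  have hanti : AntitoneOn (fun s => (P s ^ 3 - r s ^ 3) / (P s ^ 3 - p s ^ 3)) (Icc 0 T) := by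
    refine antitoneOn_of_deriv_nonpos (convex_Icc 0 T) ?_ ?_ ?_
    · exact (hP.continuousOn_cube.sub hr.continuousOn_cube).div
        (hP.continuousOn_cube.sub hp.continuousOn_cube) fun s hs => (hM s hs).ne'
    · rw [interior_Icc]
      exact fun s hs => (hd s hs).differentiableAt.differentiableWithinAt
    · rw [interior_Icc]
      intro s hs
      have hs' := Ioo_subset_Icc_self hs
      have h1 := hp.pos s hs'
      have h2 := hpr' s hs'
      have h3 := hrP' s hs'
      have h4 := hpos s hs'
      rw [(hd s hs).deriv]
      refine div_nonpos_of_nonpos_of_nonneg ?_ (sq_nonneg _)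
      -- The sign of this expression is the concavity of the cube root.
      have h5 : (P s - r s) / l s * (P s ^ 3 - p s ^ 3) - (P s ^ 3 - r s ^ 3) *
          ((P s - p s) / l s) =
          -((P s - r s) * (P s - p s) * (r s - p s) * (P s + r s + p s) / l s) := by
        field_simp
        ring
      rw [h5, neg_nonpos]
      have := sub_pos.2 h2
      have := sub_pos.2 h3
      have := sub_pos.2 (h2.trans h3)
      have : 0 < r s := h1.trans h2
      have : 0 < P s := this.trans h3
      positivity
  exact hanti ⟨le_rfl, hT⟩ ⟨hT, le_rfl⟩ hT

theorem IsChar.hasDerivAt_div (hp : IsChar l T p) (hP : IsChar l T P) {s : ℝ} (hs : s ∈ Ioo 0 T)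
    (hl : 0 < l s) :
    HasDerivAt (fun s => p s / P s)
      (-(P s - p s) * (P s ^ 2 + P s * p s + p s ^ 2 - P s / l s * (p s * P s + p s ^ 2))
        / (3 * p s ^ 2 * P s ^ 4)) s := by
  have h1 := hp.pos s (Ioo_subset_Icc_self hs)
  have h2 := hP.pos s (Ioo_subset_Icc_self hs)
  refine ((hp.hasDerivAt s hs).div (hP.hasDerivAt s hs) h2.ne').congr_deriv ?_
  field_simp
  ring

/-- As long as `x ≤ (4/3)³ L` along the top characteristic, the slope of the flow at a lower
characteristic is controlled by the mean slope between the two characteristics. -/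
theorem IsChar.slope_le (hT : 0 ≤ T) (hp : IsChar l T p) (hr : IsChar l T r) (hP : IsChar l T P)
    (hl : ContinuousOn l (Icc 0 T)) (hpos : ∀ s ∈ Icc 0 T, 0 < l s) (hpr : p T < r T)
    (hpP : p T < P T) (hscale : ∀ s ∈ Ioo 0 T, P s ≤ 4 / 3 * l s) :
    (r T ^ 3 - p T ^ 3) * (P 0 ^ 3 - p 0 ^ 3) ≤
      Real.exp 6 * ((r 0 ^ 3 - p 0 ^ 3) * (P T ^ 3 - p T ^ 3)) := by
  have hpr' := hp.lt_of_lt hr hl hpos hpr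
  have hpP' := hp.lt_of_lt hP hl hpos hpP
  have hN : ∀ s ∈ Icc 0 T, 0 < r s ^ 3 - p s ^ 3 := fun s hs => hp.cube_lt hs (hpr' s hs)
  have hM : ∀ s ∈ Icc 0 T, 0 < P s ^ 3 - p s ^ 3 := fun s hs => hp.cube_lt hs (hpP' s hs)
  -- The logarithmic derivative of (r³ - p³)/(P³ - p³) is at most 2(P - p)/(3p²P²), which has no
  -- uniform integral in time. The ratio p/P falls at least at one sixth of this rate, so adding
  -- 6p/P makes the sum decrease; as 0 < p/P < 1, this costs only the factor e⁶.
  set f : ℝ → ℝ := fun s =>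
    Real.log (r s ^ 3 - p s ^ 3) - Real.log (P s ^ 3 - p s ^ 3) + 6 * (p s / P s) with hf
  have hd : ∀ s ∈ Ioo 0 T, HasDerivAt f _ s := fun s hs =>
    (((hp.hasDerivAt_cube_sub hr hs).log (hN s (Ioo_subset_Icc_self hs)).ne').sub
      ((hp.hasDerivAt_cube_sub hP hs).log (hM s (Ioo_subset_Icc_self hs)).ne')).add
      ((hp.hasDerivAt_div hP hs (hpos s (Ioo_subset_Icc_self hs))).const_mul 6)
  have hanti : AntitoneOn f (Icc 0 T) := by
    refine antitoneOn_of_deriv_nonpos (convex_Icc 0 T) ?_ ?_ ?_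
    · exact (((hr.continuousOn_cube.sub hp.continuousOn_cube).log fun s hs => (hN s hs).ne').sub
        ((hP.continuousOn_cube.sub hp.continuousOn_cube).log fun s hs => (hM s hs).ne')).add
        (continuousOn_const.mul (hp.continuousOn.div hP.continuousOn
          fun s hs => (hP.pos s hs).ne'))
    · rw [interior_Icc]
      exact fun s hs => (hd s hs).differentiableAt.differentiableWithinAt
    · rw [interior_Icc]
      intro s hs
      have hs' := Ioo_subset_Icc_self hs
      have h1 := hp.pos s hs'
      have h2 := hpr' s hs'
      have h3 := hpP' s hs'
      have h4 := hpos s hs'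
      have h5 := hscale s hs
      have hr0 : 0 < r s := h1.trans h2
      have hP0 : 0 < P s := h1.trans h3
      rw [(hd s hs).deriv]
      have hlam : P s / l s ≤ 4 / 3 := (div_le_iff₀ h4).2 h5
      have e1 : (r s - p s) / l s / (r s ^ 3 - p s ^ 3) =
          1 / (l s * (r s ^ 2 + r s * p s + p s ^ 2)) := by
        have := (hN s hs').ne'
        have h6 : 0 < r s ^ 2 + r s * p s + p s ^ 2 := by positivity
        field_simp
        ring
      have e2 : (P s - p s) / l s / (P s ^ 3 - p s ^ 3) =
          1 / (l s * (P s ^ 2 + P s * p s + p s ^ 2)) := by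
        have := (hM s hs').ne'
        have h6 : 0 < P s ^ 2 + P s * p s + p s ^ 2 := by positivity
        field_simp
        ring
      have e3 : 1 / (l s * (r s ^ 2 + r s * p s + p s ^ 2)) ≤ 1 / (l s * (3 * p s ^ 2)) := by
        refine one_div_le_one_div_of_le (by positivity) (mul_le_mul_of_nonneg_left ?_ h4.le)
        nlinarith
      have e4 : 1 / (l s * (3 * p s ^ 2)) - 1 / (l s * (P s ^ 2 + P s * p s + p s ^ 2)) =
          P s / l s * ((P s - p s) * (P s + 2 * p s)) /
            (3 * p s ^ 2 * P s * (P s ^ 2 + P s * p s + p s ^ 2)) := by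
        field_simp
        ring
      have e5 : P s / l s * ((P s - p s) * (P s + 2 * p s)) /
            (3 * p s ^ 2 * P s * (P s ^ 2 + P s * p s + p s ^ 2)) ≤
          2 * (P s - p s) / (3 * p s ^ 2 * P s ^ 2) := by
        rw [div_le_div_iff₀ (by positivity) (by positivity)]
        have h6 : 0 < P s - p s := sub_pos.2 h3
        have h7 : P s / l s * (P s + 2 * p s) * P s ≤ 2 * (P s ^ 2 + P s * p s + p s ^ 2) := by
          have : P s / l s * ((P s + 2 * p s) * P s) ≤ 4 / 3 * ((P s + 2 * p s) * P s) :=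
            mul_le_mul_of_nonneg_right hlam (by positivity)
          nlinarith [sq_nonneg (P s - p s), sq_nonneg (P s - 2 * p s)]
        have h8 := mul_le_mul_of_nonneg_right h7
          (show 0 ≤ (P s - p s) * (3 * p s ^ 2 * P s) by positivity)
        linarith
      have e6 : 6 * (-(P s - p s) * (P s ^ 2 + P s * p s + p s ^ 2 -
            P s / l s * (p s * P s + p s ^ 2)) / (3 * p s ^ 2 * P s ^ 4)) ≤
          -(2 * (P s - p s) / (3 * p s ^ 2 * P s ^ 2)) := by
        rw [← neg_div, ← mul_div_assoc, div_le_div_iff₀ (by positivity) (by positivity)]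
        have h6 : 0 < P s - p s := sub_pos.2 h3
        have h7 : P s ^ 2 ≤ 3 * (P s ^ 2 + P s * p s + p s ^ 2 -
            P s / l s * (p s * P s + p s ^ 2)) := by
          have : P s / l s * (p s * P s + p s ^ 2) ≤ 4 / 3 * (p s * P s + p s ^ 2) :=
            mul_le_mul_of_nonneg_right hlam (by positivity)
          nlinarith
        have h8 := mul_le_mul_of_nonneg_right h7
          (show 0 ≤ 2 * (P s - p s) * (3 * p s ^ 2 * P s ^ 2) by positivity)
        linarith
      rw [e1, e2]
      linarith
  have h1 : f T ≤ f 0 := hanti ⟨le_rfl, hT⟩ ⟨hT, le_rfl⟩ hT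
  have h0 : (0 : ℝ) ∈ Icc 0 T := ⟨le_rfl, hT⟩
  have hTm : T ∈ Icc 0 T := ⟨hT, le_rfl⟩
  have h2 : p 0 / P 0 ≤ 1 := (div_le_one (hP.pos 0 h0)).2 (hpP' 0 h0).le
  have h3 : 0 ≤ p T / P T := (div_pos (hp.pos T hTm) (hP.pos T hTm)).le
  have h4 : Real.log ((r T ^ 3 - p T ^ 3) * (P 0 ^ 3 - p 0 ^ 3)) ≤
      Real.log (Real.exp 6 * ((r 0 ^ 3 - p 0 ^ 3) * (P T ^ 3 - p T ^ 3))) := by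
    have a1 := hN 0 h0
    have a2 := hN T hTm
    have a3 := hM 0 h0
    have a4 := hM T hTm
    rw [Real.log_mul a2.ne' a3.ne', Real.log_mul (Real.exp_pos 6).ne' (mul_pos a1 a4).ne',
      Real.log_mul a1.ne' a4.ne', Real.log_exp]
    simp only [hf] at h1
    linarith
  exact (Real.log_le_log_iff (mul_pos (hN T hTm) (hM 0 h0))
    (mul_pos (Real.exp_pos 6) (mul_pos (hN 0 h0) (hM T hTm)))).1 h4

/-- Lower characteristics separate exponentially from the top one, as long as the latter is
bounded. -/
theorem IsChar.sub_le_exp (hT : 0 ≤ T) (hp : IsChar l T p) (hP : IsChar l T P)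
    (hl : ContinuousOn l (Icc 0 T)) (hpos : ∀ s ∈ Icc 0 T, 0 < l s)
    (hpP : p T < P T) (hscale : ∀ s ∈ Ioo 0 T, P s ≤ 4 / 3 * l s) {κ : ℝ} (hκ : 0 < κ)
    (hbound : ∀ s ∈ Ioo 0 T, P s ^ 3 * κ ≤ 2) :
    P 0 ^ 3 - p 0 ^ 3 ≤ P 0 ^ 3 * Real.exp (-κ * T / 18) := by
  have hpP' := hp.lt_of_lt hP hl hpos hpP
  -- The relative distance 1 - (p/P)³ to the top never exceeds 1 and grows at logarithmic rate at
  -- least κ/18.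
  set f : ℝ → ℝ := fun s => (1 - (p s / P s) ^ 3) * Real.exp (-κ / 18 * s) with hf
  have hd : ∀ s ∈ Ioo 0 T, HasDerivAt f _ s := fun s hs =>
    (((hp.hasDerivAt_div hP hs (hpos s (Ioo_subset_Icc_self hs))).pow 3).const_sub 1).mul
      (((hasDerivAt_id s).const_mul (-κ / 18)).exp)
  have hmono : MonotoneOn f (Icc 0 T) := by
    refine monotoneOn_of_deriv_nonneg (convex_Icc 0 T) ?_ ?_ ?_
    · exact (continuousOn_const.sub ((hp.continuousOn.div hP.continuousOn
          fun s hs => (hP.pos s hs).ne').pow 3)).mul (by fun_prop)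
    · rw [interior_Icc]
      exact fun s hs => (hd s hs).differentiableAt.differentiableWithinAt
    · rw [interior_Icc]
      intro s hs
      have hs' := Ioo_subset_Icc_self hs
      have h1 := hp.pos s hs'
      have h3 := hpP' s hs'
      have h4 := hpos s hs'
      have h5 := hscale s hs
      have hb := hbound s hs
      have hP0 : 0 < P s := h1.trans h3
      have hlam : P s / l s ≤ 4 / 3 := (div_le_iff₀ h4).2 h5
      rw [(hd s hs).deriv]
      simp only [id, mul_one, Pi.pow_apply]
      have e1 : κ / 18 * (1 - (p s / P s) ^ 3) ≤ (P s ^ 3 - p s ^ 3) / (9 * P s ^ 6) := by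
        have : κ / 18 * (1 - (p s / P s) ^ 3) = (P s ^ 3 * κ) * ((P s ^ 3 - p s ^ 3) /
            (18 * P s ^ 6)) := by
          field_simp
        rw [this]
        have h6 : 0 ≤ (P s ^ 3 - p s ^ 3) / (18 * P s ^ 6) :=
          div_nonneg (hp.cube_lt hs' h3).le (by positivity)
        calc _ ≤ 2 * ((P s ^ 3 - p s ^ 3) / (18 * P s ^ 6)) := mul_le_mul_of_nonneg_right hb h6
          _ = _ := by field_simp; ring
      have e2 : -(3 * (p s / P s) ^ 2 * (-(P s - p s) * (P s ^ 2 + P s * p s + p s ^ 2 -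
            P s / l s * (p s * P s + p s ^ 2)) / (3 * p s ^ 2 * P s ^ 4))) =
          (P s - p s) * (P s ^ 2 + P s * p s + p s ^ 2 -
            P s / l s * (p s * P s + p s ^ 2)) / P s ^ 6 := by
        generalize P s ^ 2 + P s * p s + p s ^ 2 - P s / l s * (p s * P s + p s ^ 2) = X
        field_simp
      have e3 : (P s ^ 3 - p s ^ 3) / (9 * P s ^ 6) ≤
          (P s - p s) * (P s ^ 2 + P s * p s + p s ^ 2 -
            P s / l s * (p s * P s + p s ^ 2)) / P s ^ 6 := by
        rw [div_le_div_iff₀ (by positivity) (by positivity)]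
        have h6 : 0 < P s - p s := sub_pos.2 h3
        -- By P/l ≤ 4/3 and p < P the bracket is at least P²/3, while the left side is at most 3P².
        have h7 : P s ^ 2 + P s * p s + p s ^ 2 ≤ 9 * (P s ^ 2 + P s * p s + p s ^ 2 -
            P s / l s * (p s * P s + p s ^ 2)) := by
          have : P s / l s * (p s * P s + p s ^ 2) ≤ 4 / 3 * (p s * P s + p s ^ 2) :=
            mul_le_mul_of_nonneg_right hlam (by positivity)
          nlinarith
        have h8 := mul_le_mul_of_nonneg_right h7
          (show 0 ≤ (P s - p s) * P s ^ 6 by positivity)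
        linarith
      norm_num at e2 ⊢
      have h9 := Real.exp_pos (-κ / 18 * s)
      have h10 := mul_le_mul_of_nonneg_right (e1.trans (e3.trans e2.ge)) h9.le
      nlinarith
  have h1 : f 0 ≤ f T := hmono ⟨le_rfl, hT⟩ ⟨hT, le_rfl⟩ hT
  have h0 : (0 : ℝ) ∈ Icc 0 T := ⟨le_rfl, hT⟩
  have hTm : T ∈ Icc 0 T := ⟨hT, le_rfl⟩
  have h2 : f T ≤ Real.exp (-κ * T / 18) := by
    have e : -κ / 18 * T = -κ * T / 18 := by ring
    simp only [hf, e]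
    refine mul_le_of_le_one_left (Real.exp_pos _).le ?_
    have : 0 ≤ (p T / P T) ^ 3 := pow_nonneg (div_pos (hp.pos T hTm) (hP.pos T hTm)).le 3
    linarith
  have h3 : P 0 ^ 3 - p 0 ^ 3 = P 0 ^ 3 * f 0 := by
    have := (hP.pos 0 h0).ne'
    simp only [hf, mul_zero, Real.exp_zero, mul_one]
    field_simp
  rw [h3]
  exact mul_le_mul_of_nonneg_left (h1.trans h2) (hP.cube_pos h0).le

end Comparison

theorem exists_cube_eq {x : ℝ} (hx : 0 < x) : ∃ q : ℝ, 0 < q ∧ q ^ 3 = x := by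
  refine ⟨x ^ (((3 : ℕ) : ℝ)⁻¹), Real.rpow_pos_of_pos hx _, ?_⟩
  exact Real.rpow_inv_natCast_pow hx.le three_ne_zero

/-! ### A priori bounds on the support and the origin of its points -/

section

variable {w₀ : ℝ → ℝ} {w : ℝ → ℝ → ℝ} {a ε δ : ℝ}

theorem IsProfile.lt_of_pos (hw₀ : IsProfile w₀ a ε δ) {x : ℝ} (hx : 0 < w₀ x) : x < a := by
  by_contra! hax
  rw [hw₀.eq_zero x hax] at hx
  exact lt_irrefl _ hx

theorem IsSolution.initial_eq (h : IsSolution w₀ w) {T : ℝ} {p : ℝ → ℝ} (hT : 0 ≤ T)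
    (hp : IsChar (scaleRoot w) T p) (hw : 0 < w (p T ^ 3) T) :
    w₀ (p 0 ^ 3) = w (p T ^ 3) T := by
  rw [← h.eq_of_isChar hp hw ⟨le_rfl, hT⟩, h.initial _ (hp.cube_pos ⟨le_rfl, hT⟩).le]

theorem IsSolution.start_lt (h : IsSolution w₀ w) (hw₀ : IsProfile w₀ a ε δ) {T : ℝ} {p : ℝ → ℝ}
    (hT : 0 ≤ T) (hp : IsChar (scaleRoot w) T p) (hw : 0 < w (p T ^ 3) T) : p 0 ^ 3 < a :=
  hw₀.lt_of_pos ((h.initial_eq hT hp hw).symm ▸ hw)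

/-- This is `linear_le` transported by the concave flow, with the end point `a` replaced by any
point `A` at which w is still positive. -/
theorem IsSolution.mul_sub_le_of_lt (h : IsSolution w₀ w) (hw₀ : IsProfile w₀ a ε δ)
    {t x₁ x A : ℝ} (ht : 0 ≤ t) (hx₁ : 0 < x₁) (hx : x₁ < x) (hA : x < A) (hw : 0 < w A t) :
    w x₁ t * (A - x) ≤ w x t * (A - x₁) := by
  obtain ⟨q₁, hq₁, rfl⟩ := exists_cube_eq hx₁
  obtain ⟨q, hq, rfl⟩ := exists_cube_eq (hx₁.trans hx)
  obtain ⟨Q, hQ, rfl⟩ := exists_cube_eq (hx₁.trans (hx.trans hA))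
  obtain ⟨p, hp, hpt⟩ := h.exists_isChar ht hq₁
  obtain ⟨r, hr, hrt⟩ := h.exists_isChar ht hq
  obtain ⟨P, hP, hPt⟩ := h.exists_isChar ht hQ
  have hqq : q₁ < q := lt_of_pow_lt_pow_left₀ 3 hq.le hx
  have hqQ : q < Q := lt_of_pow_lt_pow_left₀ 3 hQ.le hA
  have hl := h.continuousOn_scaleRoot t
  have hpos : ∀ s ∈ Icc 0 t, 0 < scaleRoot w s := fun s hs => h.scaleRoot_pos hs.1
  have hc := IsChar.concave ht hp hr hP hl hpos (by rw [hpt, hrt]; exact hqq)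
    (by rw [hrt, hPt]; exact hqQ)
  have h0 : (0 : ℝ) ∈ Icc 0 t := ⟨le_rfl, ht⟩
  have hpr0 := hp.lt_of_lt hr hl hpos (by rw [hpt, hrt]; exact hqq) 0 h0
  have hrP0 := hr.lt_of_lt hP hl hpos (by rw [hrt, hPt]; exact hqQ) 0 h0
  have hwx : 0 < w (q ^ 3) t := hw.trans_le
    (h.antitoneOn t ht (mem_Ici.2 (by positivity)) (mem_Ici.2 (by positivity)) hA.le)
  have hwx₁ : 0 < w (q₁ ^ 3) t := hwx.trans_le
    (h.antitoneOn t ht (mem_Ici.2 (by positivity)) (mem_Ici.2 (by positivity)) hx.le)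
  rw [← hpt] at hwx₁
  rw [← hrt] at hwx
  rw [← hPt] at hw
  have e1 := h.initial_eq ht hp hwx₁
  have e2 := h.initial_eq ht hr hwx
  have hPa := h.start_lt hw₀ ht hP hw
  have y1 := hp.cube_pos h0
  have y2 := hp.cube_lt h0 hpr0
  have y3 := hr.cube_lt h0 hrP0
  have hlin := hw₀.linear_le (p 0 ^ 3) (r 0 ^ 3) y1.le (by linarith) (by linarith)
  rw [e1, e2] at hlin
  rw [hpt, hrt, hPt, div_le_div_iff₀ (by linarith) (by linarith)] at hc
  rw [hpt] at hlin hwx₁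
  rw [hrt] at hlin hwx
  -- the ratio `(A - y) / (A - y₁)` increases with `A`
  have h1 : (P 0 ^ 3 - r 0 ^ 3) * (a - p 0 ^ 3) ≤ (a - r 0 ^ 3) * (P 0 ^ 3 - p 0 ^ 3) := by
    nlinarith
  have hap : 0 < a - p 0 ^ 3 := by linarith
  have hPp : 0 < P 0 ^ 3 - p 0 ^ 3 := by linarith
  have h2 : (Q ^ 3 - q ^ 3) * (a - p 0 ^ 3) ≤ (Q ^ 3 - q₁ ^ 3) * (a - r 0 ^ 3) := by
    refine le_of_mul_le_mul_right ?_ hPp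
    have h3 := mul_le_mul_of_nonneg_right hc hap.le
    have h4 := mul_le_mul_of_nonneg_left h1 (show 0 ≤ Q ^ 3 - q₁ ^ 3 by linarith)
    linarith
  refine le_of_mul_le_mul_right ?_ hap
  have h5 := mul_le_mul_of_nonneg_left h2 hwx₁.le
  have h6 := mul_le_mul_of_nonneg_left hlin (show 0 ≤ Q ^ 3 - q₁ ^ 3 by linarith)
  linarith

theorem IsSolution.zero_mul_sub_le (h : IsSolution w₀ w) (hw₀ : IsProfile w₀ a ε δ)
    {t x A : ℝ} (ht : 0 ≤ t) (hx : 0 < x) (hA : x ≤ A) (hw : 0 < w A t) :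
    w 0 t * (A - x) ≤ w x t * A := by
  rcases hA.eq_or_lt with rfl | hA
  · have := mul_pos hw hx
    simpa using this.le
  have h0 : ContinuousWithinAt (fun y => w y t) (Ioi 0) 0 :=
    (h.continuousOn_space ht 0 self_mem_Ici).mono Ioi_subset_Ici_self
  have h1 : Tendsto (fun y => w y t * (A - x)) (𝓝[>] 0) (𝓝 (w 0 t * (A - x))) :=
    h0.tendsto.mul_const _
  have h2 : Tendsto (fun y => w x t * (A - y)) (𝓝[>] 0) (𝓝 (w x t * (A - 0))) :=
    (Continuous.tendsto (by fun_prop) 0).mono_left nhdsWithin_le_nhds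
  rw [sub_zero] at h2
  refine le_of_tendsto_of_tendsto h1 h2 ?_
  filter_upwards [Ioo_mem_nhdsGT hx] with y hy
  exact h.mul_sub_le_of_lt hw₀ ht hy.1 hy.2 hA hw

/-- The triangle under the chord from (0, w(0,t)) to (A, 0) has area at most the mass 1. -/
theorem IsSolution.mul_zero_le_two (h : IsSolution w₀ w) (hw₀ : IsProfile w₀ a ε δ)
    {t A : ℝ} (ht : 0 ≤ t) (hA : 0 < A) (hw : 0 < w A t) : A * w 0 t ≤ 2 := by
  have h1 : ∫ x in Ioc 0 A, w 0 t * (A - x) ≤ ∫ x in Ioc 0 A, w x t * A :=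
    setIntegral_mono_on ((Continuous.integrableOn_Icc (by fun_prop)).mono_set Ioc_subset_Icc_self)
      (((h.integrableOn t ht).mono_set Ioc_subset_Ioi_self).mul_const A) measurableSet_Ioc
      fun x hx => h.zero_mul_sub_le hw₀ ht hx.1 hx.2 hw
  have h2 : ∫ x in Ioc 0 A, w x t ≤ ∫ x in Ioi 0, w x t :=
    setIntegral_mono_set (h.integrableOn t ht)
      ((ae_restrict_mem measurableSet_Ioi).mono fun y hy => h.nonneg y t (le_of_lt hy) ht)
      Ioc_subset_Ioi_self.eventuallyLE
  rw [h.mass t ht] at h2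
  rw [integral_mul_const, ← intervalIntegral.integral_of_le hA.le,
    intervalIntegral.integral_const_mul, intervalIntegral.integral_sub (by simp) (by simp)] at h1
  simp only [intervalIntegral.integral_const, sub_zero, smul_eq_mul, integral_id] at h1
  have h3 : A * (A * w 0 t) ≤ A * 2 := by nlinarith
  exact le_of_mul_le_mul_left h3 hA

theorem integral_rpow_mul_sub {P : ℝ} (hP : 0 < P) :
    IntegrableOn (fun x => x ^ (-(2 / 3) : ℝ) * (P ^ 3 - x)) (Ioc 0 (P ^ 3)) ∧
    ∫ x in Ioc 0 (P ^ 3), x ^ (-(2 / 3) : ℝ) * (P ^ 3 - x) = 9 / 4 * P ^ 4 := by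
  have hA : 0 < P ^ 3 := by positivity
  have e : ∀ x ∈ Ioc 0 (P ^ 3), x ^ (-(2 / 3) : ℝ) * (P ^ 3 - x) =
      P ^ 3 * x ^ (-(2 / 3) : ℝ) - x ^ (1 / 3 : ℝ) := by
    intro x hx
    have : x ^ (1 / 3 : ℝ) = x ^ (-(2 / 3) : ℝ) * x := by
      rw [← Real.rpow_add_one hx.1.ne']; norm_num
    rw [this]; ring
  have i1 : IntervalIntegrable (fun x : ℝ => P ^ 3 * x ^ (-(2 / 3) : ℝ)) volume 0 (P ^ 3) :=
    (intervalIntegral.intervalIntegrable_rpow' (by norm_num)).const_mul _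
  have i2 : IntervalIntegrable (fun x : ℝ => x ^ (1 / 3 : ℝ)) volume 0 (P ^ 3) :=
    intervalIntegral.intervalIntegrable_rpow' (by norm_num)
  constructor
  · rw [integrableOn_congr_fun e measurableSet_Ioc,
      ← intervalIntegrable_iff_integrableOn_Ioc_of_le hA.le]
    exact i1.sub i2
  · rw [setIntegral_congr_fun measurableSet_Ioc e, ← intervalIntegral.integral_of_le hA.le,
      intervalIntegral.integral_sub i1 i2, intervalIntegral.integral_const_mul,
      integral_rpow (Or.inl (by norm_num)), integral_rpow (Or.inl (by norm_num))]
    have e1 : (P ^ 3) ^ (-(2 / 3) + 1 : ℝ) = P := by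
      rw [← Real.rpow_natCast, ← Real.rpow_mul hP.le]; norm_num
    have e2 : (P ^ 3) ^ (1 / 3 + 1 : ℝ) = P ^ 4 := by
      rw [← Real.rpow_natCast, ← Real.rpow_mul hP.le, ← Real.rpow_natCast]; norm_num
    rw [e1, e2, Real.zero_rpow (by norm_num), Real.zero_rpow (by norm_num)]
    ring

/-- Integrating the chord to A = P³ against x^{-2/3} gives L^{1/3} ≥ (1/3)(9/4) P = (3/4) P. -/
theorem IsSolution.le_scaleRoot (h : IsSolution w₀ w) (hw₀ : IsProfile w₀ a ε δ)
    {t P : ℝ} (ht : 0 ≤ t) (hP : 0 < P) (hw : 0 < w (P ^ 3) t) : P ≤ 4 / 3 * scaleRoot w t := by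
  have hA : 0 < P ^ 3 := by positivity
  have hz := h.zero_pos ht
  obtain ⟨hi, he⟩ := integral_rpow_mul_sub hP
  have hint := h.integrableOn_rpow_mul ht
  have h1 : ∫ x in Ioc 0 (P ^ 3), w 0 t * (x ^ (-(2 / 3) : ℝ) * (P ^ 3 - x)) ≤
      ∫ x in Ioc 0 (P ^ 3), P ^ 3 * (x ^ (-(2 / 3) : ℝ) * w x t) := by
    refine setIntegral_mono_on (hi.const_mul _) ((hint.mono_set Ioc_subset_Ioi_self).const_mul _)
      measurableSet_Ioc fun x hx => ?_
    have := mul_le_mul_of_nonneg_left (h.zero_mul_sub_le hw₀ ht hx.1 hx.2 hw)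
      (Real.rpow_nonneg hx.1.le (-(2 / 3)))
    linarith
  have h2 : ∫ x in Ioc 0 (P ^ 3), x ^ (-(2 / 3) : ℝ) * w x t ≤
      ∫ x in Ioi 0, x ^ (-(2 / 3) : ℝ) * w x t :=
    setIntegral_mono_set hint ((ae_restrict_mem measurableSet_Ioi).mono fun y hy =>
      mul_nonneg (Real.rpow_nonneg (le_of_lt hy) _) (h.nonneg y t (le_of_lt hy) ht))
      Ioc_subset_Ioi_self.eventuallyLE
  rw [integral_const_mul, integral_const_mul, he] at h1
  have h3 : P ^ 3 * (w 0 t * (9 / 4 * P)) ≤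
      P ^ 3 * ∫ x in Ioi 0, x ^ (-(2 / 3) : ℝ) * w x t := by
    have := mul_le_mul_of_nonneg_left h2 hA.le
    nlinarith
  have h4 := le_of_mul_le_mul_left h3 hA
  rw [scaleRoot, ← mul_div_assoc, le_div_iff₀ hz]
  linarith

/-- Along a characteristic in the support, `x ≤ (4/3)³ L`. -/
theorem IsSolution.char_le_scaleRoot (h : IsSolution w₀ w) (hw₀ : IsProfile w₀ a ε δ)
    {T : ℝ} {P : ℝ → ℝ} (hP : IsChar (scaleRoot w) T P) (hw : 0 < w (P T ^ 3) T) {s : ℝ}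
    (hs : s ∈ Ioo 0 T) : P s ≤ 4 / 3 * scaleRoot w s :=
  h.le_scaleRoot hw₀ hs.1.le (hP.pos s (Ioo_subset_Icc_self hs))
    (by rwa [h.eq_of_isChar hP hw (Ioo_subset_Icc_self hs)])

/-- By w ≤ 1/x and continuity, w(·,T) takes every small positive value. A characteristic carrying
such a value replaces the edge of the support, where the equation is not assumed. -/
theorem IsSolution.exists_isChar_small (h : IsSolution w₀ w) {T η : ℝ} (hT : 0 ≤ T) (hη : 0 < η) :
    ∃ P, IsChar (scaleRoot w) T P ∧ 0 < w (P T ^ 3) T ∧ w (P T ^ 3) T < η := by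
  have hz := h.zero_pos hT
  set v := min η (w 0 T) / 2 with hv
  have hm : 0 < min η (w 0 T) := lt_min hη hz
  have hv0 : 0 < v := by positivity
  have hvη : v < η := by linarith [min_le_left η (w 0 T)]
  have hvz : v < w 0 T := by linarith [min_le_right η (w 0 T)]
  set X := v⁻¹ with hX
  have hX0 : 0 < X := inv_pos.2 hv0
  have hwX : w X T ≤ v := by
    have := h.mul_le_one hX0.le hT
    rw [hX, inv_mul_le_iff₀ hv0, mul_one] at this
    exact this
  obtain ⟨x, hx, hxv⟩ := intermediate_value_Icc' hX0.le
    ((h.continuousOn_space hT).mono Icc_subset_Ici_self) ⟨hwX, hvz.le⟩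
  have hxv : w x T = v := hxv
  have hx0 : 0 < x := hx.1.lt_of_ne (by rintro rfl; linarith)
  obtain ⟨q, hq, rfl⟩ := exists_cube_eq hx0
  obtain ⟨P, hP, hPT⟩ := h.exists_isChar hT hq
  refine ⟨P, hP, ?_, ?_⟩ <;> rw [hPT, hxv] <;> assumption

/-- A characteristic below a given one and a top characteristic that starts close to the end of
the support of the initial data. -/
theorem IsSolution.exists_top (h : IsSolution w₀ w) (hw₀ : IsProfile w₀ a ε δ) {T η : ℝ}
    {p : ℝ → ℝ} (hT : 0 ≤ T) (hp : IsChar (scaleRoot w) T p) (hw : 0 < w (p T ^ 3) T)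
    (hη : 0 < η) :
    ∃ P, IsChar (scaleRoot w) T P ∧ 0 < w (P T ^ 3) T ∧ w (P T ^ 3) T < η ∧ p T < P T ∧
      (a - p 0 ^ 3) / 2 ≤ P 0 ^ 3 - p 0 ^ 3 := by
  have h0 : (0 : ℝ) ∈ Icc 0 T := ⟨le_rfl, hT⟩
  have hTm : T ∈ Icc 0 T := ⟨hT, le_rfl⟩
  have hpa := h.start_lt hw₀ hT hp hw
  have hp0 := hp.cube_pos h0
  -- A value below this one can only start beyond the midpoint of p(0)³ and a.
  have hmid : 0 < w₀ ((a + p 0 ^ 3) / 2) := hw₀.pos _ (by linarith) (by linarith)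
  obtain ⟨P, hP, hP1, hP2⟩ := h.exists_isChar_small hT (lt_min hη (lt_min hw hmid))
  have hP3 := hP2.trans_le (min_le_right _ _)
  refine ⟨P, hP, hP1, hP2.trans_le (min_le_left _ _), ?_, ?_⟩
  · by_contra! hle
    have := h.antitoneOn T hT (mem_Ici.2 (hP.cube_pos hTm).le) (mem_Ici.2 (hp.cube_pos hTm).le)
      (pow_le_pow_left₀ (hP.pos T hTm).le hle 3)
    exact (hP3.trans_le (min_le_left _ _)).not_ge this
  · by_contra! hlt
    have h1 := hw₀.antitoneOn (mem_Ici.2 (hP.cube_pos h0).le)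
      (mem_Ici.2 (show 0 ≤ (a + p 0 ^ 3) / 2 by linarith))
      (show P 0 ^ 3 ≤ (a + p 0 ^ 3) / 2 by linarith)
    rw [h.initial_eq hT hP hP1] at h1
    exact (hP3.trans_le (min_le_right _ _)).not_ge h1

/-- After a time that depends on `a` and `ε` only, the support consists of points that come from
`(a - ε, a)`. -/
theorem IsSolution.lt_start (h : IsSolution w₀ w) (hw₀ : IsProfile w₀ a ε δ) {T : ℝ}
    (hT : 0 ≤ T) (hlarge : 2 * a * Real.exp (-(ε / a ^ 2) * T / 18) < ε) {p : ℝ → ℝ}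
    (hp : IsChar (scaleRoot w) T p) (hw : 0 < w (p T ^ 3) T) : a - ε < p 0 ^ 3 := by
  have h0 : (0 : ℝ) ∈ Icc 0 T := ⟨le_rfl, hT⟩
  have ha := hw₀.end_pos
  have hpa := h.start_lt hw₀ hT hp hw
  have hp0 := hp.cube_pos h0
  -- A small carried value already puts the start y near a, since w₀(y) ≥ w₀(0)(a - y)/a ≥ (a -
  -- y)/a². A large one serves as the rate κ of exponential separation, because P³ w(0,s) ≤ 2; the 2
  -- in `hlarge` pays for the half in `exists_top`.
  rcases lt_or_ge (w (p T ^ 3) T) (ε / a ^ 2) with hκ | hκ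
  · rw [← h.initial_eq hT hp hw, lt_div_iff₀ (by positivity)] at hκ
    have h1 := hw₀.linear_le 0 (p 0 ^ 3) le_rfl hp0.le hpa
    rw [sub_zero] at h1
    have h2 := mul_le_mul_of_nonneg_right hw₀.one_le (sub_pos.2 hpa).le
    nlinarith
  · obtain ⟨P, hP, hP1, -, hpP, hhalf⟩ := h.exists_top hw₀ hT hp hw one_pos
    have hPa := h.start_lt hw₀ hT hP hP1
    have h1 := IsChar.sub_le_exp hT hp hP (h.continuousOn_scaleRoot T)
      (fun s hs => h.scaleRoot_pos hs.1) hpP (fun s hs => h.char_le_scaleRoot hw₀ hP hP1 hs) hw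
      (fun s hs => by
        have hs' := Ioo_subset_Icc_self hs
        have e1 := h.mul_zero_le_two hw₀ hs.1.le (hP.cube_pos hs')
          (by rwa [h.eq_of_isChar hP hP1 hs'])
        have e2 := h.antitoneOn s hs.1.le self_mem_Ici (mem_Ici.2 (hp.cube_pos hs').le)
          (hp.cube_pos hs').le
        simp only [h.eq_of_isChar hp hw hs'] at e2
        exact (mul_le_mul_of_nonneg_left e2 (hP.cube_pos hs').le).trans e1)
    have h2 : Real.exp (-w (p T ^ 3) T * T / 18) ≤ Real.exp (-(ε / a ^ 2) * T / 18) := by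
      refine Real.exp_le_exp.2 ?_
      nlinarith [mul_le_mul_of_nonneg_right hκ hT]
    have h3 : P 0 ^ 3 * Real.exp (-w (p T ^ 3) T * T / 18) ≤
        a * Real.exp (-(ε / a ^ 2) * T / 18) :=
      mul_le_mul hPa.le h2 (Real.exp_pos _).le ha.le
    linarith

/-! ### Linear growth of 1/w(0,t) -/

/-- Both points start in (a - ε, a), where `decay` bounds the drop of w₀ below in terms of the
initial distance; `slope_le` converts that into the present distance. In the constant, e⁶ comes from
`slope_le`, and 4 is the 2 of P³ w ≤ 2 times the 2 lost in `exists_top`. -/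
theorem IsSolution.inv_sub_inv_ge (h : IsSolution w₀ w) (hw₀ : IsProfile w₀ a ε δ)
    (hδ : 0 < δ) {T : ℝ} (hT : 0 ≤ T)
    (hlarge : 2 * a * Real.exp (-(ε / a ^ 2) * T / 18) < ε) {x z : ℝ} (hx : 0 < x) (hxz : x < z)
    (hw : 0 < w z T) :
    δ / (4 * Real.exp 6) * (z - x) ≤ (w z T)⁻¹ - (w x T)⁻¹ := by
  obtain ⟨q, hq, rfl⟩ := exists_cube_eq hx
  obtain ⟨q', hq', rfl⟩ := exists_cube_eq (hx.trans hxz)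
  obtain ⟨p, hp, rfl⟩ := h.exists_isChar hT hq
  obtain ⟨r, hr, rfl⟩ := h.exists_isChar hT hq'
  have h0 : (0 : ℝ) ∈ Icc 0 T := ⟨le_rfl, hT⟩
  have hpr : p T < r T := lt_of_pow_lt_pow_left₀ 3 hq'.le hxz
  have hl := h.continuousOn_scaleRoot T
  have hpos : ∀ s ∈ Icc 0 T, 0 < scaleRoot w s := fun s hs => h.scaleRoot_pos hs.1
  have hwx : 0 < w (p T ^ 3) T := hw.trans_le
    (h.antitoneOn T hT (mem_Ici.2 hx.le) (mem_Ici.2 (hx.trans hxz).le) hxz.le)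
  obtain ⟨P, hP, hP1, -, hpP, hhalf⟩ := h.exists_top hw₀ hT hp hwx one_pos
  have hsl := IsChar.slope_le hT hp hr hP hl hpos hpr hpP
    (fun s hs => h.char_le_scaleRoot hw₀ hP hP1 hs)
  have hPT : 0 < P T ^ 3 := hP.cube_pos ⟨hT, le_rfl⟩
  have hA : P T ^ 3 * w (p T ^ 3) T ≤ 2 :=
    (mul_le_mul_of_nonneg_left (h.antitoneOn T hT self_mem_Ici (mem_Ici.2 hx.le) hx.le)
      hPT.le).trans (h.mul_zero_le_two hw₀ hT hPT hP1)
  have hyz := hp.cube_lt h0 (hp.lt_of_lt hr hl hpos hpr 0 h0)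
  have hpa := h.start_lt hw₀ hT hp hwx
  have hdec := hw₀.decay (p 0 ^ 3) (r 0 ^ 3) (hp.cube_pos h0)
    (h.lt_start hw₀ hT hlarge hp hwx) (by linarith) (h.start_lt hw₀ hT hr hw)
  rw [h.initial_eq hT hp hwx, h.initial_eq hT hr hw] at hdec
  set wx := w (p T ^ 3) T
  set wz := w (r T ^ 3) T
  set D := r 0 ^ 3 - p 0 ^ 3
  set E := Real.exp 6 with hE
  have hE0 : 0 < E := Real.exp_pos 6
  set B := a - p 0 ^ 3
  have hB : 0 < B := sub_pos.2 hpa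
  set d := r T ^ 3 - p T ^ 3
  have hd : 0 < d := sub_pos.2 hxz
  have h1 : d * (B / 2) ≤ E * (D * P T ^ 3) := by
    refine (mul_le_mul_of_nonneg_left hhalf hd.le).trans (hsl.trans ?_)
    refine mul_le_mul_of_nonneg_left (mul_le_mul_of_nonneg_left ?_ hyz.le) hE0.le
    linarith
  have h2 : δ * wz * wx * d * B ≤ 4 * E * (wx - wz) * B := by
    have a1 := mul_le_mul_of_nonneg_left h1 (show 0 ≤ δ * wz * wx by positivity)
    have a2 := mul_le_mul_of_nonneg_right hA (show 0 ≤ E * (δ * wz * D) by positivity)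
    have a3 := mul_le_mul_of_nonneg_left hdec hE0.le
    linarith
  have h3 := le_of_mul_le_mul_right h2 hB
  rw [inv_sub_inv hw.ne' hwx.ne', div_mul_eq_mul_div, div_le_div_iff₀ (by positivity)
    (by positivity)]
  linarith

theorem IsSolution.sq_le_neg_deriv (h : IsSolution w₀ w) (hw₀ : IsProfile w₀ a ε δ)
    (hδ : 0 < δ) {T : ℝ} (hT : 0 < T)
    (hlarge : 2 * a * Real.exp (-(ε / a ^ 2) * T / 18) < ε) {x : ℝ} (hx : 0 < x)
    (hw : 0 < w x T) :
    δ / (4 * Real.exp 6) * w x T ^ 2 ≤ -deriv (fun y => w y T) x := by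
  have hd := h.hasDerivAt_space hx hT hw
  have hd2 := (hd.fun_inv hw.ne').hasDerivWithinAt (s := Ioi x)
  rw [hasDerivWithinAt_iff_tendsto_slope' self_notMem_Ioi] at hd2
  have hev : ∀ᶠ z in 𝓝[>] x, δ / (4 * Real.exp 6) ≤ slope (fun y => (w y T)⁻¹) x z := by
    filter_upwards [nhdsWithin_le_nhds (hd.continuousAt.eventually_const_lt hw),
      self_mem_nhdsWithin] with z hz hxz
    rw [slope_def_field, le_div_iff₀ (sub_pos.2 hxz)]
    exact h.inv_sub_inv_ge hw₀ hδ hT.le hlarge hx hxz hz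
  have := ge_of_tendsto hd2 hev
  rw [le_div_iff₀ (by positivity)] at this
  rwa [hd.deriv]

/-- At fixed x = q³ the equation gives ∂(1/w)/∂t = (1 - q/l)(-∂w/∂x)/w² ≥ k(1 - q/l). It is not
assumed at x = 0, so it is integrated at small q > 0 and then q → 0. -/
theorem IsSolution.inv_zero_ge (h : IsSolution w₀ w) (hw₀ : IsProfile w₀ a ε δ) (hε : 0 < ε)
    (hδ : 0 < δ) {T₀ T : ℝ} (hT₀ : 0 < T₀) (hT : T₀ ≤ T)
    (hlarge : 2 * a * Real.exp (-(ε / a ^ 2) * T₀ / 18) < ε) :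
    δ / (4 * Real.exp 6) * (T - T₀) ≤ (w 0 T)⁻¹ := by
  have hT' : 0 ≤ T := hT₀.le.trans hT
  set k := δ / (4 * Real.exp 6) with hk
  have hk0 : 0 < k := by positivity
  have hlarge' : ∀ t, T₀ ≤ t → 2 * a * Real.exp (-(ε / a ^ 2) * t / 18) < ε := by
    intro t ht
    refine lt_of_le_of_lt (mul_le_mul_of_nonneg_left (Real.exp_le_exp.2 ?_)
      (mul_pos two_pos hw₀.end_pos).le) hlarge
    have : 0 < ε / a ^ 2 := div_pos hε (pow_pos hw₀.end_pos 2)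
    nlinarith
  obtain ⟨P, hP, hP1, -⟩ := h.exists_isChar_small hT' one_pos
  obtain ⟨t₁, ht₁, hmin⟩ := isCompact_Icc.exists_isMinOn (nonempty_Icc.2 hT') hP.continuousOn
  obtain ⟨t₂, ht₂, hmin₂⟩ := isCompact_Icc.exists_isMinOn (nonempty_Icc.2 hT')
    (h.continuousOn_scaleRoot T)
  set e := P t₁ with he
  set m := scaleRoot w t₂ with hm
  have he0 : 0 < e := hP.pos t₁ ht₁
  have hm0 : 0 < m := h.scaleRoot_pos ht₂.1
  -- Below the minimum of a surviving characteristic w stays positive, so the equation holds at q³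
  -- for all t in (0, T].
  have hpos : ∀ q, 0 < q → q < e → ∀ t ∈ Icc 0 T, 0 < w (q ^ 3) t := by
    intro q hq hqe t ht
    have h1 : e ≤ P t := hmin ht
    refine (hP1.trans_eq (h.eq_of_isChar hP hP1 ht).symm).trans_le ?_
    exact h.antitoneOn t ht.1 (mem_Ici.2 (by positivity)) (mem_Ici.2 (hP.cube_pos ht).le)
      (pow_le_pow_left₀ hq.le (hqe.le.trans h1) 3)
  have key : ∀ q, 0 < q → q < min e m → k * (1 - q / m) * (T - T₀) ≤ (w (q ^ 3) T)⁻¹ := by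
    intro q hq hqm
    have hqe := hqm.trans_le (min_le_left _ _)
    have hqm := hqm.trans_le (min_le_right _ _)
    have hx : 0 < q ^ 3 := by positivity
    have hI : ∀ t ∈ Icc T₀ T, t ∈ Icc 0 T := fun t ht => ⟨hT₀.le.trans ht.1, ht.2⟩
    have hd : ∀ t ∈ Ioo T₀ T, HasDerivAt (fun t => (w (q ^ 3) t)⁻¹ - k * (1 - q / m) * t) _ t :=
      fun t ht => ((h.hasDerivAt_time hx (hT₀.trans ht.1)
        (hpos q hq hqe t (hI t (Ioo_subset_Icc_self ht)))).fun_inv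
        (hpos q hq hqe t (hI t (Ioo_subset_Icc_self ht))).ne').sub
        ((hasDerivAt_id t).const_mul (k * (1 - q / m)))
    have hmono : MonotoneOn (fun t => (w (q ^ 3) t)⁻¹ - k * (1 - q / m) * t) (Icc T₀ T) := by
      refine monotoneOn_of_deriv_nonneg (convex_Icc T₀ T) ?_ ?_ ?_
      · refine ContinuousOn.sub (ContinuousOn.inv₀ ((h.continuousOn_time hx.le).mono
          fun t ht => (hI t ht).1) fun t ht => (hpos q hq hqe t (hI t ht)).ne') (by fun_prop)
      · rw [interior_Icc]
        exact fun t ht => (hd t ht).differentiableAt.differentiableWithinAt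
      · rw [interior_Icc]
        intro t ht
        have ht' := hI t (Ioo_subset_Icc_self ht)
        have ht0 : 0 < t := hT₀.trans ht.1
        have hw := hpos q hq hqe t ht'
        rw [(hd t ht).deriv, ← (h.hasDerivAt_time hx ht0 hw).deriv,
          h.transport_scaleRoot hq ht0 hw, mul_one, sub_nonneg, le_div_iff₀ (by positivity)]
        have h1 := h.sq_le_neg_deriv hw₀ hδ ht0 (hlarge' t ht.1.le) hx hw
        have h2 : m ≤ scaleRoot w t := hmin₂ ht'
        have h3 : q / scaleRoot w t ≤ q / m := div_le_div_of_nonneg_left hq.le hm0 h2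
        have h4 : 0 ≤ 1 - q / m := sub_nonneg.2 ((div_le_one hm0).2 hqm.le)
        have h5 := mul_le_mul (sub_le_sub_left h3 1) h1 (by positivity) (by linarith)
        linarith
    have h1 : (w (q ^ 3) T₀)⁻¹ - k * (1 - q / m) * T₀ ≤ (w (q ^ 3) T)⁻¹ - k * (1 - q / m) * T :=
      hmono ⟨le_rfl, hT⟩ ⟨hT, le_rfl⟩ hT
    have h2 : 0 < (w (q ^ 3) T₀)⁻¹ := inv_pos.2 (hpos q hq hqe T₀ ⟨hT₀.le, hT⟩)
    linarith
  have hlim1 : Tendsto (fun q => k * (1 - q / m) * (T - T₀)) (𝓝[>] 0)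
      (𝓝 (k * (1 - 0 / m) * (T - T₀))) :=
    (Continuous.tendsto (by fun_prop) 0).mono_left nhdsWithin_le_nhds
  have hlim2 : Tendsto (fun q => (w (q ^ 3) T)⁻¹) (𝓝[>] 0) (𝓝 (w 0 T)⁻¹) := by
    refine Tendsto.inv₀ ?_ (h.zero_pos hT').ne'
    have h1 : Tendsto (fun q : ℝ => q ^ 3) (𝓝[>] 0) (𝓝[≥] 0) := by
      refine tendsto_nhdsWithin_iff.2 ⟨?_, ?_⟩
      · have : Tendsto (fun q : ℝ => q ^ 3) (𝓝 0) (𝓝 (0 ^ 3)) := Continuous.tendsto (by fun_prop) 0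
        rw [zero_pow three_ne_zero] at this
        exact this.mono_left nhdsWithin_le_nhds
      · exact eventually_nhdsWithin_of_forall fun q hq => mem_Ici.2 (pow_pos (mem_Ioi.1 hq) 3).le
    exact (h.continuousOn_space hT' 0 self_mem_Ici).tendsto.comp h1
  have := le_of_tendsto_of_tendsto hlim1 hlim2 (by
    filter_upwards [Ioo_mem_nhdsGT (lt_min he0 hm0)] with q hq using key q hq.1 hq.2)
  simpa using this

/-- Values at small x > 0 are carried from values of `w₀`, all at most `w₀ 0`. -/
theorem IsSolution.zero_le_initial (h : IsSolution w₀ w) (hw₀ : IsProfile w₀ a ε δ) {T : ℝ}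
    (hT : 0 ≤ T) : w 0 T ≤ w₀ 0 := by
  have h1 : Tendsto (fun x => w x T) (𝓝[>] 0) (𝓝 (w 0 T)) :=
    (h.continuousOn_space hT 0 self_mem_Ici).mono Ioi_subset_Ici_self
  refine le_of_tendsto h1 ?_
  filter_upwards [h1.eventually_const_lt (h.zero_pos hT), self_mem_nhdsWithin] with x hx hx0
  obtain ⟨q, hq, rfl⟩ := exists_cube_eq hx0
  obtain ⟨p, hp, rfl⟩ := h.exists_isChar hT hq
  rw [← h.initial_eq hT hp hx]
  have := (hp.cube_pos ⟨le_rfl, hT⟩).le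
  exact hw₀.antitoneOn self_mem_Ici (mem_Ici.2 this) this

/-! ### Mean cluster volume -/

/-- On the bounded support, ∫ c = w(0,t), and integration by parts gives ∫ x c = ∫ w = 1. -/
theorem IsSolution.meanVolume_eq (h : IsSolution w₀ w) (hw₀ : IsProfile w₀ a ε δ) {t : ℝ}
    (ht : 0 < t) : meanVolume w t = (w 0 t)⁻¹ := by
  have hz := h.zero_pos ht.le
  set S := {x : ℝ | 0 ≤ x ∧ 0 < w x t} with hS
  have hbdd : BddAbove S := by
    refine ⟨2 / w 0 t, fun x hx => ?_⟩
    rw [le_div_iff₀ hz]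
    rcases hx.1.eq_or_lt with rfl | hx0
    · simp
    · exact h.mul_zero_le_two hw₀ ht.le hx0 hx.2
  have hne : S.Nonempty := ⟨0, le_rfl, hz⟩
  set e := sSup S with he
  have he0 : 0 ≤ e := le_csSup hbdd ⟨le_rfl, hz⟩
  have hin : ∀ x ∈ Ioo 0 e, 0 < w x t := by
    intro x hx
    obtain ⟨y, hy, hxy⟩ := exists_lt_of_lt_csSup hne hx.2
    exact hy.2.trans_le (h.antitoneOn t ht.le (mem_Ici.2 hx.1.le) (mem_Ici.2 hy.1) hxy.le)
  have hout : ∀ x, e < x → w x t = 0 := fun x hx =>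
    le_antisymm (not_lt.1 fun hw => hx.not_ge (le_csSup hbdd ⟨he0.trans hx.le, hw⟩))
      (h.nonneg x t (he0.trans hx.le) ht.le)
  have hwe : w e t = 0 := by
    have h1 : Tendsto (fun x => w x t) (𝓝[>] e) (𝓝 (w e t)) :=
      ((h.continuousOn_space ht.le) e he0).mono fun x hx => he0.trans (le_of_lt hx)
    exact tendsto_nhds_unique h1 (tendsto_const_nhds.congr'
      (eventually_nhdsWithin_of_forall fun x hx => (hout x hx).symm))
  have hdout : ∀ x, e < x → density w x t = 0 := by
    intro x hx
    have : (fun y => w y t) =ᶠ[𝓝 x] fun _ => 0 := by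
      filter_upwards [Ioi_mem_nhds hx] with y hy using hout y hy
    rw [density, this.deriv_eq]; simp
  have hder : ∀ x ∈ Ioo 0 e, HasDerivAt (fun y => -w y t) (density w x t) x := fun x hx => by
    have := h.hasDerivAt_space hx.1 ht (hin x hx)
    rw [density, this.deriv]
    exact this.fun_neg
  have hcont : ContinuousOn (fun y => w y t) (Icc 0 e) :=
    (h.continuousOn_space ht.le).mono Icc_subset_Ici_self
  have hdnn : ∀ x ∈ Ioo 0 e, 0 ≤ density w x t := by
    intro x hx
    have h1 := (hder x hx).hasDerivWithinAt (s := Ioi x)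
    rw [hasDerivWithinAt_iff_tendsto_slope' self_notMem_Ioi] at h1
    refine ge_of_tendsto h1 ?_
    filter_upwards [self_mem_nhdsWithin] with y hy
    rw [slope_def_field]
    have hy : x < y := hy
    have := h.antitoneOn t ht.le (mem_Ici.2 hx.1.le) (mem_Ici.2 (hx.1.le.trans hy.le)) hy.le
    exact div_nonneg (by linarith) (by linarith)
  -- Integrability of c is not assumed; it follows from c ≥ 0 and the continuity of its primitive -w
  -- up to the end points.
  have hint : IntegrableOn (fun x => density w x t) (Ioc 0 e) :=
    intervalIntegral.integrableOn_deriv_of_nonneg hcont.neg hder hdnn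
  have hint1 : IntervalIntegrable (fun x => density w x t) volume 0 e :=
    (intervalIntegrable_iff_integrableOn_Ioc_of_le he0).2 hint
  have hint2 : IntervalIntegrable (fun x => x * density w x t) volume 0 e :=
    hint1.continuousOn_mul continuousOn_id
  have hint3 : IntervalIntegrable (fun x => w x t) volume 0 e :=
    (intervalIntegrable_iff_integrableOn_Ioc_of_le he0).2
      ((h.integrableOn t ht.le).mono_set Ioc_subset_Ioi_self)
  have hres : ∀ f : ℝ → ℝ, (∀ x, e < x → f x = 0) →
      ∫ x in Ioi 0, f x = ∫ x in (0 : ℝ)..e, f x := by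
    intro f hf
    rw [intervalIntegral.integral_of_le he0]
    exact setIntegral_eq_of_subset_of_forall_sdiff_eq_zero measurableSet_Ioi Ioc_subset_Ioi_self
      fun x hx => hf x (not_le.1 fun hxe => hx.2 ⟨hx.1, hxe⟩)
  have I1 : ∫ x in Ioi 0, density w x t = w 0 t := by
    rw [hres _ hdout, intervalIntegral.integral_eq_sub_of_hasDerivAt_of_le he0 hcont.neg hder hint1]
    simp [hwe]
  have I2 : ∫ x in Ioi 0, x * density w x t = 1 := by
    rw [hres _ fun x hx => by rw [hdout x hx, mul_zero]]
    have h1 := intervalIntegral.integral_eq_sub_of_hasDerivAt_of_le he0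
      (f := fun x => x * -w x t) (f' := fun x => -w x t + x * density w x t)
      (continuousOn_id.mul hcont.neg)
      (fun x hx => ((hasDerivAt_id x).mul (hder x hx)).congr_deriv (by simp))
      (hint3.neg.add hint2)
    have h2 : ∫ x in (0 : ℝ)..e, (-w x t + x * density w x t) =
        (∫ x in (0 : ℝ)..e, -w x t) + ∫ x in (0 : ℝ)..e, x * density w x t :=
      intervalIntegral.integral_add hint3.neg hint2
    rw [h2, intervalIntegral.integral_neg, hwe, ← hres (fun x => w x t) hout, h.mass t ht.le] at h1
    linarith
  rw [meanVolume, I1, I2, one_div]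

end

/-! ### Choice of constants and conclusion -/

theorem exists_pos_forall_lt_of_liminf {a : ℝ} {b : ℝ → ℝ}
    (hb : 0 < liminf (fun x : ℝ => (b x : EReal)) (leftOf (a : EReal))) :
    ∃ ε δ : ℝ, 0 < ε ∧ 0 < δ ∧ ∀ x, a - ε < x → x < a → δ ≤ b x := by
  obtain ⟨δ, hδ0, hδ⟩ := EReal.lt_iff_exists_real_btwn.1 hb
  have hev : ∀ᶠ x in leftOf (a : EReal), (δ : EReal) < b x := eventually_lt_of_lt_liminf hδ
  have hle : 𝓝[<] a ≤ leftOf (a : EReal) := by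
    rw [leftOf, ← map_le_iff_le_comap]
    refine tendsto_nhdsWithin_iff.2 ⟨?_, ?_⟩
    · exact continuous_coe_real_ereal.continuousAt.tendsto.mono_left nhdsWithin_le_nhds
    · exact eventually_nhdsWithin_of_forall fun x hx => EReal.coe_lt_coe_iff.2 hx
  obtain ⟨c, hc, hsub⟩ := mem_nhdsLT_iff_exists_Ioo_subset.1 (hle hev)
  have hc : c < a := hc
  refine ⟨a - c, δ, sub_pos.2 hc, by exact_mod_cast hδ0, fun x hx hxa => ?_⟩
  have : (δ : EReal) < b x := hsub ⟨by linarith, hxa⟩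
  exact (EReal.coe_lt_coe_iff.1 this).le

theorem exists_time_exp_lt {a ε : ℝ} (ha : 0 < a) (hε : 0 < ε) :
    ∃ T₀ : ℝ, 0 < T₀ ∧ 2 * a * Real.exp (-(ε / a ^ 2) * T₀ / 18) < ε := by
  have hc : 0 < ε / a ^ 2 / 18 := by positivity
  have h1 : Tendsto (fun T : ℝ => 2 * a * Real.exp (-(ε / a ^ 2 / 18 * T))) atTop
      (𝓝 (2 * a * 0)) :=
    (Real.tendsto_exp_neg_atTop_nhds_zero.comp (tendsto_id.const_mul_atTop hc)).const_mul _
  rw [mul_zero] at h1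
  obtain ⟨T, hT, hT0⟩ := ((h1.eventually_lt_const hε).and (eventually_gt_atTop 0)).exists
  refine ⟨T, hT0, ?_⟩
  have e : -(ε / a ^ 2) * T / 18 = -(ε / a ^ 2 / 18 * T) := by ring
  rwa [e]

end LSW

theorem proposition4p3 :
    ∃ βmax : ℝ, 0 < βmax ∧
      -- the beta function `b` of the initial data, with its domain `[0, a)`
      ∀ (a : EReal) (b : ℝ → ℝ),
        (∀ x ∈ LSW.interval a, b x ≤ βmax) →
        0 < Filter.liminf (fun x : ℝ => (b x : EReal)) (LSW.leftOf a) →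
        -- the constant depends only on this beta function
        ∃ C : ℝ, 0 < C ∧
          ∀ w₀ : ℝ → ℝ, LSW.IsInitialDatum w₀ →
            LSW.supportEnd w₀ = a →
            (∀ x ∈ LSW.interval a, LSW.beta w₀ x = b x) →
            ∀ w : ℝ → ℝ → ℝ, LSW.IsSolution w₀ w →
              ∀ T : ℝ, 1 ≤ T → C * T ≤ LSW.meanVolume w T := by
  -- A bound β ≤ b < 1 yields h ≥ (1 - b)(a - x) w₀ and hence -w₀'(a - x) ≤ w₀ b/(1 - b); the factor
  -- b/(1 - b) is at most 1 exactly for b ≤ 1/2.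
  refine ⟨1 / 2, by norm_num, fun A b hb hlim => ?_⟩
  by_cases hA : ∃ a : ℝ, 0 < a ∧ A = a
  swap
  · -- the support of the initial data is bounded
    refine ⟨1, one_pos, fun w₀ hw₀ hend hβ w h => absurd ?_ hA⟩
    subst hend
    exact hw₀.exists_supportEnd_eq h.continuousOn_initial fun x hx => (hβ x hx).trans_le (hb x hx)
  obtain ⟨a, ha, rfl⟩ := hA
  obtain ⟨ε, δ, hε, hδ, hbδ⟩ := LSW.exists_pos_forall_lt_of_liminf hlim
  obtain ⟨T₀, hT₀, hlarge⟩ := LSW.exists_time_exp_lt ha hε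
  have hk : 0 < δ / (4 * Real.exp 6) := by positivity
  -- For T ≤ 2T₀ the bound 1/w(0,T) ≥ 1/w₀(0) ≥ a/2 suffices; for T ≥ 2T₀ the linear growth does, as
  -- T - T₀ ≥ T/2.
  refine ⟨min (a / (4 * T₀)) (δ / (4 * Real.exp 6) / 2), lt_min (by positivity) (by positivity),
    fun w₀ hw₀ hend hβ w h T hT => ?_⟩
  have hT0 : 0 < T := one_pos.trans_le hT
  have hprof : LSW.IsProfile w₀ a ε δ := by
    refine hw₀.isProfile h.continuousOn_initial hend hδ ?_ fun x hx hax hxa => ?_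
    · rw [hend]
      exact fun x hx => (hβ x hx).trans_le (hb x hx)
    · rw [hβ x ⟨hx, EReal.coe_lt_coe_iff.2 hxa⟩]
      exact hbδ x hax hxa
  rw [h.meanVolume_eq hprof hT0]
  rcases le_total T (2 * T₀) with hle | hle
  · have h1 : a / 2 ≤ (w 0 T)⁻¹ := by
      rw [← one_div, div_le_div_iff₀ two_pos (h.zero_pos hT0.le), one_mul]
      exact (mul_le_mul_of_nonneg_left (h.zero_le_initial hprof hT0.le) ha.le).trans hprof.le_two
    refine le_trans ?_ h1
    calc _ ≤ a / (4 * T₀) * (2 * T₀) :=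
          mul_le_mul (min_le_left _ _) hle hT0.le (by positivity)
      _ = a / 2 := by field_simp; ring
  · refine le_trans ?_ (h.inv_zero_ge hprof hε hδ hT₀ (by linarith) hlarge)
    have h1 := mul_le_mul_of_nonneg_right
      (min_le_right (a / (4 * T₀)) (δ / (4 * Real.exp 6) / 2)) hT0.le
    have h2 := mul_le_mul_of_nonneg_left hle hk.le
    linarith
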